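/- Let $R=\bigoplus_{n\in\mathbb Z}R_n$ be a $\mathbb Z$-graded (associative, unital) ring which is right artinian as an ungraded ring. A graded right $R$-module is a right $R$-module $M$ with a decomposition $M=\bigoplus_{n\in\mathbb Z}M_n$ into additive subgroups such that $M_iR_j\subseteq M_{i+j}$ for all $i,j$; it is indecomposable (as a graded module) if it is nonzero and is not the direct sum of two nonzero graded submodules. The graded length of a nonzero graded module $M$ is $$\mathrm{gr.l.}(M)=\sup\{n\mid M_n\ne0\}-\inf\{n\mid M_n\ne0\}+1\in\mathbb N\cup\{\infty\}.$$ A right $R$-module is gradable if it is isomorphic to the underlying module of some graded right $R$-module. Put $$G_R=\sup\{\mathrm{gr.l.}(M)\mid M\text{ a finitely generated indecomposable graded right }R\text{-module}\}.$$ Then: 1. If $G_R<\infty$, then every finitely generated right $R$-module is gradable. 2. $R$ has finite representation type (i.e. there are only finitely many finitely generated indecomposable right $R$-modules up to isomorphism) if and only if there are only finitely many finitely generated indecomposable gradable right $R$-modules up to isomorphism. 3. If $R$ has finite representation type, then every finitely generated right $R$-module is gradable. -/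

import Mathlib

universe u

/-- A `ℤ`-graded right `R`-module `M = ⨁ Mₙ` over a ring graded by `𝒜`. Right `R`-modules are
`Rᵐᵒᵖ`-modules, so that `m * r` is written `MulOpposite.op r • m`. -/
structure GradedRightModule {R : Type u} [Ring R] (𝒜 : ℤ → AddSubgroup R) where
  carrier : Type u
  [addCommGroup : AddCommGroup carrier]
  [module : Module Rᵐᵒᵖ carrier]
  /-- the homogeneous component of degree `n` -/
  piece : ℤ → AddSubgroup carrier
  [decomposition : DirectSum.Decomposition piece]
  smul_mem : ∀ (i j : ℤ) (m : carrier) (r : R), m ∈ piece i → r ∈ 𝒜 j →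
    MulOpposite.op r • m ∈ piece (i + j)

attribute [instance] GradedRightModule.addCommGroup GradedRightModule.module
  GradedRightModule.decomposition

/-- A module is indecomposable if it is nonzero and is not the direct sum of two nonzero
submodules. -/
def IsIndecomposableModule (S : Type u) [Ring S] (M : Type u) [AddCommGroup M] [Module S M] :
    Prop :=
  Nontrivial M ∧ ∀ N N' : Submodule S M, IsCompl N N' → N = ⊥ ∨ N' = ⊥

namespace GradedRightModule

variable {R : Type u} [Ring R] {𝒜 : ℤ → AddSubgroup R}

/-- A graded module is indecomposable (as a graded module) if it is nonzero and is not the direct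
sum of two nonzero graded submodules. -/
def IsIndecomposable (M : GradedRightModule 𝒜) : Prop :=
  Nontrivial M.carrier ∧ ∀ N N' : Submodule Rᵐᵒᵖ M.carrier,
    N.IsHomogeneous M.piece → N'.IsHomogeneous M.piece → IsCompl N N' → N = ⊥ ∨ N' = ⊥

/-- The graded length `sup {n | Mₙ ≠ 0} - inf {n | Mₙ ≠ 0} + 1 ∈ ℕ ∪ {∞}` of a nonzero graded
module, written as the supremum of `j - i + 1` over all `i ≤ j` with `Mᵢ ≠ 0` and `Mⱼ ≠ 0`. -/
noncomputable def gradedLength (M : GradedRightModule 𝒜) : ℕ∞ :=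
  ⨆ (i : ℤ) (j : ℤ) (_ : i ≤ j) (_ : M.piece i ≠ ⊥) (_ : M.piece j ≠ ⊥),
    (((j - i).toNat + 1 : ℕ) : ℕ∞)

end GradedRightModule

/-- `G_R`: the supremum of the graded lengths of the finitely generated graded right modules that
are indecomposable as graded modules. -/
noncomputable def supGradedLength {R : Type u} [Ring R] (𝒜 : ℤ → AddSubgroup R) : ℕ∞ :=
  ⨆ (M : GradedRightModule 𝒜) (_ : Module.Finite Rᵐᵒᵖ M.carrier) (_ : M.IsIndecomposable),
    M.gradedLength

/-- A right `R`-module is gradable if it is isomorphic to the module underlying some graded right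
`R`-module. -/
def IsGradable {R : Type u} [Ring R] (𝒜 : ℤ → AddSubgroup R)
    (N : Type u) [AddCommGroup N] [Module Rᵐᵒᵖ N] : Prop :=
  ∃ M : GradedRightModule 𝒜, Nonempty (M.carrier ≃ₗ[Rᵐᵒᵖ] N)

/-- There are only finitely many modules with the property `P` up to isomorphism. -/
def FinitelyManyUpToIso {S : Type u} [Ring S] (P : ModuleCat.{u} S → Prop) : Prop :=
  ∃ (n : ℕ) (X : Fin n → ModuleCat.{u} S), (∀ k, P (X k)) ∧
    ∀ M : ModuleCat.{u} S, P M → ∃ k, Nonempty (M ≃ₗ[S] X k)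

/-- `R` has finite representation type (on the right): up to isomorphism there are only finitely
many finitely generated indecomposable right `R`-modules. -/
def FiniteRepresentationType (R : Type u) [Ring R] : Prop :=
  FinitelyManyUpToIso fun M : ModuleCat.{u} Rᵐᵒᵖ =>
    Module.Finite Rᵐᵒᵖ M ∧ IsIndecomposableModule Rᵐᵒᵖ M

/-- Up to isomorphism there are only finitely many finitely generated indecomposable gradable right
`R`-modules. -/
def FinitelyManyGradableIndecomposables {R : Type u} [Ring R] (𝒜 : ℤ → AddSubgroup R) : Prop :=
  FinitelyManyUpToIso fun M : ModuleCat.{u} Rᵐᵒᵖ =>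
    Module.Finite Rᵐᵒᵖ M ∧ IsIndecomposableModule Rᵐᵒᵖ M ∧ IsGradable 𝒜 M

/-- Every finitely generated right `R`-module is gradable. -/
def EveryFGModuleGradable {R : Type u} [Ring R] (𝒜 : ℤ → AddSubgroup R) : Prop :=
  ∀ (N : Type u) [AddCommGroup N] [Module Rᵐᵒᵖ N], Module.Finite Rᵐᵒᵖ N → IsGradable 𝒜 N

/-! The engine is a nilpotence statement. Let `M` be an indecomposable graded module of finite
length with bounded support. By a Harada–Sai argument (`length_range_of_mem_pow`), long products of
homogeneous non-isomorphisms of `M` vanish, so sums of such maps are nilpotent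
(`isNilpotent_of_mem_span`). Endomorphisms of nonzero degree are never bijective, hence an
endomorphism is determined by its degree zero component up to a nilpotent one. Three facts follow:
an endomorphism whose degree zero component is the identity is invertible; the module underlying `M`
is indecomposable; and if that module is isomorphic to one underlying another graded module of
bounded support, some homogeneous component of the isomorphism is injective, which compares the
graded lengths.

Bounded support is automatic for finite length over an artinian ring (`exists_isBounded`). It
reduces to graded simple modules, where unbounded support would produce a nonzero endomorphism `f`
of nonzero degree; then `1 - f` is injective but not surjective, contradicting artinianity.

For the first claim, let `N` be finitely generated and nonzero, and let `G` bound the graded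
lengths. In the graded module `N[t, t⁻¹]` take a finitely generated graded submodule containing all
of `N * t ^ i` for `i` in a large window, and an indecomposable graded summand `Z` of it that is
nonzero in degree 0. Then `Z` lives in degrees `[-G, G]`. Evaluation at `t = 1` gives `u : Z → N`,
and summing the projections of `x * t ^ i` gives `v : N → Z`. The degree zero component of `v ∘ u`
is the identity, so `Z` is a nonzero gradable summand of `N`, and induction on the complement
finishes.

For the other claims, if there are only finitely many finitely generated gradable indecomposables,
the underlying modules of graded indecomposables are among them, and the comparison of graded
lengths makes `G_R` finite (`supGradedLength_lt_top`). Then every finitely generated module is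
gradable by the first claim. -/

namespace GradedRightModule

variable {R : Type u} [Ring R] {𝒜 : ℤ → AddSubgroup R}

/-! ### Projections onto homogeneous components. -/

section Proj

variable (M : GradedRightModule 𝒜)

/-- The projection of a graded module onto its component of degree `i`. -/
def proj (i : ℤ) : M.carrier →+ M.carrier where
  toFun x := (DirectSum.decompose M.piece x i : M.carrier)
  map_zero' := by simp
  map_add' x y := by simp

variable {M}

theorem proj_mem (i : ℤ) (x : M.carrier) : M.proj i x ∈ M.piece i :=
  (DirectSum.decompose M.piece x i).2

theorem proj_eq_self {i : ℤ} {x : M.carrier} (hx : x ∈ M.piece i) : M.proj i x = x :=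
  DirectSum.decompose_of_mem_same M.piece hx

theorem proj_eq_zero {i j : ℤ} {x : M.carrier} (hx : x ∈ M.piece i) (h : i ≠ j) :
    M.proj j x = 0 :=
  DirectSum.decompose_of_mem_ne M.piece hx h

theorem exists_sum_proj (x : M.carrier) :
    ∃ s : Finset ℤ, (∀ i ∉ s, M.proj i x = 0) ∧ ∑ i ∈ s, M.proj i x = x := by
  classical
  refine ⟨(DirectSum.decompose M.piece x).support, fun i hi => ?_,
    DirectSum.sum_support_decompose M.piece x⟩
  rw [DFinsupp.notMem_support_iff] at hi
  simp [proj, hi]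

theorem sum_proj {x : M.carrier} {s : Finset ℤ} (hs : ∀ i ∉ s, M.proj i x = 0) :
    ∑ i ∈ s, M.proj i x = x := by
  classical
  obtain ⟨t, ht, htx⟩ := exists_sum_proj x
  calc ∑ i ∈ s, M.proj i x = ∑ i ∈ t ∪ s, M.proj i x :=
        Finset.sum_subset Finset.subset_union_right fun i _ hi => hs i hi
    _ = ∑ i ∈ t, M.proj i x :=
        (Finset.sum_subset Finset.subset_union_left fun i _ hi => ht i hi).symm
    _ = x := htx

theorem ext_proj {x y : M.carrier} (h : ∀ i, M.proj i x = M.proj i y) : x = y := by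
  obtain ⟨s, hs, hsx⟩ := exists_sum_proj x
  rw [← hsx, ← sum_proj (x := y) (s := s) (fun i hi => by rw [← h, hs i hi])]
  exact Finset.sum_congr rfl fun i _ => h i

theorem homogeneous_induction {p : M.carrier → Prop} (zero : p 0)
    (homogeneous : ∀ i, ∀ x ∈ M.piece i, p x) (add : ∀ x y, p x → p y → p (x + y)) (x) : p x :=
  DirectSum.Decomposition.inductionOn M.piece zero (fun {i} m => homogeneous i m m.2) add x

theorem proj_smul {j : ℤ} {r : R} (hr : r ∈ 𝒜 j) (i : ℤ) (x : M.carrier) :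
    M.proj (i + j) (MulOpposite.op r • x) = MulOpposite.op r • M.proj i x := by
  induction x using homogeneous_induction with
  | zero => simp
  | homogeneous k x hx =>
    have h := M.smul_mem k j x r hx hr
    by_cases hk : k = i
    · subst hk
      rw [proj_eq_self h, proj_eq_self hx]
    · rw [proj_eq_zero h (by omega), proj_eq_zero hx hk, smul_zero]
  | add x y hx hy => simp [hx, hy]

theorem isHomogeneous_iff {N : Submodule Rᵐᵒᵖ M.carrier} :
    N.IsHomogeneous M.piece ↔ ∀ i, ∀ x ∈ N, M.proj i x ∈ N :=
  Iff.rfl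

end Proj

/-- The elements of a graded ring are sums of homogeneous ones. -/
theorem ring_induction [GradedRing 𝒜] {p : R → Prop} (zero : p 0)
    (homogeneous : ∀ i, ∀ x ∈ 𝒜 i, p x) (add : ∀ x y, p x → p y → p (x + y)) (x) : p x :=
  DirectSum.Decomposition.inductionOn 𝒜 zero (fun {i} m => homogeneous i m m.2) add x

/-- An additive map between modules over a graded ring which commutes with homogeneous scalars is
linear. -/
def linearMapOfHomogeneous [GradedRing 𝒜] {C D : Type*} [AddCommGroup C] [Module Rᵐᵒᵖ C]
    [AddCommGroup D] [Module Rᵐᵒᵖ D] (f : C →+ D)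
    (hf : ∀ j, ∀ r ∈ 𝒜 j, ∀ x, f (MulOpposite.op r • x) = MulOpposite.op r • f x) :
    C →ₗ[Rᵐᵒᵖ] D where
  toFun := f
  map_add' := map_add f
  map_smul' r x := by
    obtain ⟨r, rfl⟩ := MulOpposite.op_surjective r
    induction r using ring_induction (𝒜 := 𝒜) with
    | zero => simp
    | homogeneous j r hr => exact hf j r hr x
    | add r s hr hs => simpa [add_smul] using congrArg₂ (· + ·) hr hs

@[simp]
theorem linearMapOfHomogeneous_apply [GradedRing 𝒜] {C D : Type*} [AddCommGroup C] [Module Rᵐᵒᵖ C]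
    [AddCommGroup D] [Module Rᵐᵒᵖ D] (f : C →+ D)
    (hf : ∀ j, ∀ r ∈ 𝒜 j, ∀ x, f (MulOpposite.op r • x) = MulOpposite.op r • f x) (x : C) :
    linearMapOfHomogeneous f hf x = f x :=
  rfl

/-! ### Gradings defined by orthogonal projections. -/

section OfProj

variable (C : Type u) [AddCommGroup C] [Module Rᵐᵒᵖ C] (p : ℤ → C →+ C)

/-- Locally finite orthogonal projections that sum to the identity give an internal direct sum. -/
theorem isInternal_range (hpp : ∀ i x, p i (p i x) = p i x)
    (hne : ∀ i j x, i ≠ j → p i (p j x) = 0)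
    (hsum : ∀ x, ∃ s : Finset ℤ, ∑ i ∈ s, p i x = x) :
    DirectSum.IsInternal fun i => (p i).range := by
  classical
  -- The projections recover the coordinates of `y` from its sum, whence injectivity.
  have key : ∀ (y : DirectSum ℤ fun i => (p i).range) (i : ℤ),
      p i (DirectSum.coeAddMonoidHom (fun i => (p i).range) y) = y i := by
    intro y i
    induction y using DirectSum.induction_on with
    | zero => simp
    | of k z =>
      obtain ⟨z, x, rfl⟩ := z
      rw [DirectSum.coeAddMonoidHom_of]
      by_cases h : k = i
      · subst h
        simp [hpp]
      · rw [DirectSum.of_eq_of_ne _ _ _ (Ne.symm h)]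
        simpa using hne i k x (Ne.symm h)
    | add y z hy hz => rw [map_add, map_add, hy, hz]; rfl
  refine ⟨fun y z h => ?_, fun x => ?_⟩
  · ext i
    rw [← key, ← key, h]
  · obtain ⟨s, hs⟩ := hsum x
    refine ⟨∑ i ∈ s, DirectSum.of (fun i => (p i).range) i ⟨p i x, x, rfl⟩, ?_⟩
    rw [map_sum]
    simpa using hs

/-- The graded module given by a locally finite family of orthogonal projections that sum to the
identity and shift along with homogeneous scalars. -/
noncomputable def ofProj (hpp : ∀ i x, p i (p i x) = p i x)
    (hne : ∀ i j x, i ≠ j → p i (p j x) = 0)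
    (hsum : ∀ x, ∃ s : Finset ℤ, ∑ i ∈ s, p i x = x)
    (hsmul : ∀ i j, ∀ r ∈ 𝒜 j, ∀ x,
      p (i + j) (MulOpposite.op r • x) = MulOpposite.op r • p i x) : GradedRightModule 𝒜 where
  carrier := C
  piece i := (p i).range
  decomposition := (isInternal_range C p hpp hne hsum).chooseDecomposition
  smul_mem := by
    rintro i j _ r ⟨x, rfl⟩ hr
    exact ⟨_, hsmul i j r hr x⟩

/-- The decomposition in `ofProj` comes from choice, so its projections have to be compared with `p`
on homogeneous elements. -/
theorem proj_ofProj (hpp : ∀ i x, p i (p i x) = p i x)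
    (hne : ∀ i j x, i ≠ j → p i (p j x) = 0)
    (hsum : ∀ x, ∃ s : Finset ℤ, ∑ i ∈ s, p i x = x)
    (hsmul : ∀ i j, ∀ r ∈ 𝒜 j, ∀ x,
      p (i + j) (MulOpposite.op r • x) = MulOpposite.op r • p i x) (i : ℤ) (x : C) :
    (ofProj C p hpp hne hsum hsmul).proj i x = p i x := by
  set M := ofProj C p hpp hne hsum hsmul
  change M.carrier at x
  induction x using homogeneous_induction with
  | zero => rw [map_zero]; exact (map_zero _).symm
  | homogeneous k x hx =>
    obtain ⟨y, rfl⟩ := id hx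
    by_cases h : k = i
    · subst h
      rw [proj_eq_self hx]
      exact (hpp _ _).symm
    · rw [proj_eq_zero hx h]
      exact (hne _ _ _ (Ne.symm h)).symm
  | add x y hx hy => rw [map_add, hx, hy]; exact (map_add (p i) x y).symm

end OfProj

/-! ### Graded submodules, quotients and direct sums. -/

section Constructions

variable (M : GradedRightModule 𝒜)

/-- A homogeneous submodule as a graded module. -/
noncomputable def sub (N : Submodule Rᵐᵒᵖ M.carrier) (hN : N.IsHomogeneous M.piece) :
    GradedRightModule 𝒜 :=
  ofProj N (fun i => ((M.proj i).comp N.toAddSubgroup.subtype).codRestrict N.toAddSubgroup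
      fun x => hN i x.2)
    (fun i x => Subtype.ext (proj_eq_self (proj_mem i x.1)))
    (fun i j x h => Subtype.ext (proj_eq_zero (proj_mem j x.1) (Ne.symm h)))
    (fun x => by
      obtain ⟨s, -, hs⟩ := exists_sum_proj (M := M) x.1
      refine ⟨s, Subtype.ext ?_⟩
      refine Eq.trans ?_ hs
      exact map_sum N.toAddSubgroup.subtype _ s)
    (fun i j r hr x => Subtype.ext (proj_smul hr i x.1))

/-- The inclusion of a homogeneous submodule. -/
noncomputable def subIncl (N : Submodule Rᵐᵒᵖ M.carrier) (hN : N.IsHomogeneous M.piece) :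
    (M.sub N hN).carrier →ₗ[Rᵐᵒᵖ] M.carrier :=
  N.subtype

/-- An element of a homogeneous submodule as an element of the graded module it forms. -/
noncomputable def subMk {N : Submodule Rᵐᵒᵖ M.carrier} (hN : N.IsHomogeneous M.piece)
    (x : M.carrier) (hx : x ∈ N) : (M.sub N hN).carrier :=
  (⟨x, hx⟩ : N)

variable {N : Submodule Rᵐᵒᵖ M.carrier} {hN : N.IsHomogeneous M.piece}

@[simp]
theorem subIncl_subMk (x : M.carrier) (hx : x ∈ N) : M.subIncl N hN (M.subMk hN x hx) = x :=
  rfl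

theorem subIncl_injective : Function.Injective (M.subIncl N hN) :=
  N.injective_subtype

theorem range_subIncl : LinearMap.range (M.subIncl N hN) = N :=
  N.range_subtype

theorem subIncl_proj (i : ℤ) (x : (M.sub N hN).carrier) :
    M.subIncl N hN ((M.sub N hN).proj i x) = M.proj i (M.subIncl N hN x) :=
  congrArg (Submodule.subtype N) (proj_ofProj ..)

variable {M} in
theorem mem_piece_iff {i : ℤ} {x : M.carrier} : x ∈ M.piece i ↔ M.proj i x = x :=
  ⟨proj_eq_self, fun h => h ▸ proj_mem i x⟩

theorem mem_piece_sub {i : ℤ} {x : (M.sub N hN).carrier} :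
    x ∈ (M.sub N hN).piece i ↔ M.subIncl N hN x ∈ M.piece i := by
  rw [mem_piece_iff, mem_piece_iff, ← subIncl_proj, (subIncl_injective M).eq_iff]

/-- The quotient of a graded module by a homogeneous submodule. -/
noncomputable def quotient (N : Submodule Rᵐᵒᵖ M.carrier) (hN : N.IsHomogeneous M.piece) :
    GradedRightModule 𝒜 :=
  ofProj (M.carrier ⧸ N) (fun i => QuotientAddGroup.map N.toAddSubgroup N.toAddSubgroup (M.proj i)
      fun x hx => hN i hx)
    (fun i => by
      rintro ⟨x⟩
      exact congrArg (Submodule.Quotient.mk (p := N)) (proj_eq_self (proj_mem i x)))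
    (fun i j => by
      rintro ⟨x⟩ h
      exact congrArg (Submodule.Quotient.mk (p := N)) (proj_eq_zero (proj_mem j x) (Ne.symm h)))
    (by
      rintro ⟨x⟩
      obtain ⟨s, -, hs⟩ := exists_sum_proj (M := M) x
      refine ⟨s, ?_⟩
      refine Eq.trans ?_ (congrArg N.mkQ hs)
      rw [map_sum]
      rfl)
    (fun i j r hr => by
      rintro ⟨x⟩
      exact congrArg (Submodule.Quotient.mk (p := N)) (proj_smul hr i x))

/-- The projection onto the quotient by a homogeneous submodule. -/
noncomputable def quotientMk (N : Submodule Rᵐᵒᵖ M.carrier) (hN : N.IsHomogeneous M.piece) :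
    M.carrier →ₗ[Rᵐᵒᵖ] (M.quotient N hN).carrier :=
  N.mkQ

theorem quotientMk_surjective : Function.Surjective (M.quotientMk N hN) :=
  N.mkQ_surjective

theorem ker_quotientMk : LinearMap.ker (M.quotientMk N hN) = N :=
  N.ker_mkQ

theorem proj_quotientMk (i : ℤ) (x : M.carrier) :
    (M.quotient N hN).proj i (M.quotientMk N hN x) = M.quotientMk N hN (M.proj i x) :=
  proj_ofProj ..

/-- The direct sum of two graded modules. -/
noncomputable def prod (M M' : GradedRightModule 𝒜) : GradedRightModule 𝒜 :=
  ofProj (M.carrier × M'.carrier) (fun i => (M.proj i).prodMap (M'.proj i))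
    (fun i x => Prod.ext (proj_eq_self (proj_mem i x.1)) (proj_eq_self (proj_mem i x.2)))
    (fun i j x h => Prod.ext (proj_eq_zero (proj_mem j x.1) (Ne.symm h))
      (proj_eq_zero (proj_mem j x.2) (Ne.symm h)))
    (fun x => by
      classical
      obtain ⟨s, hs, -⟩ := exists_sum_proj x.1
      obtain ⟨t, ht, -⟩ := exists_sum_proj x.2
      refine ⟨s ∪ t, Prod.ext ?_ ?_⟩
      · rw [Prod.fst_sum]
        exact sum_proj fun i hi => hs i fun h => hi (Finset.mem_union_left _ h)
      · rw [Prod.snd_sum]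
        exact sum_proj fun i hi => ht i fun h => hi (Finset.mem_union_right _ h))
    (fun i j r hr x => Prod.ext (proj_smul hr i x.1) (proj_smul hr i x.2))

end Constructions

/-! ### Homogeneous maps and components of linear maps. -/

section HasDegree

variable {M M' M'' : GradedRightModule 𝒜}

/-- A linear map between graded modules which raises degrees by `d`. -/
def HasDegree (M M' : GradedRightModule 𝒜) (d : ℤ) (f : M.carrier →ₗ[Rᵐᵒᵖ] M'.carrier) : Prop :=
  ∀ i, ∀ x ∈ M.piece i, f x ∈ M'.piece (i + d)

theorem HasDegree.proj_apply {d : ℤ} {f : M.carrier →ₗ[Rᵐᵒᵖ] M'.carrier}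
    (hf : HasDegree M M' d f) (i : ℤ) (x : M.carrier) :
    M'.proj (i + d) (f x) = f (M.proj i x) := by
  induction x using homogeneous_induction with
  | zero => simp
  | homogeneous k x hx =>
    by_cases h : k = i
    · subst h
      rw [proj_eq_self hx, proj_eq_self (hf _ _ hx)]
    · rw [proj_eq_zero hx h, proj_eq_zero (hf _ _ hx) (by omega), map_zero]
  | add x y hx hy => simp [hx, hy]

theorem HasDegree.comp {d e : ℤ} {f : M.carrier →ₗ[Rᵐᵒᵖ] M'.carrier}
    {g : M'.carrier →ₗ[Rᵐᵒᵖ] M''.carrier} (hg : HasDegree M' M'' e g) (hf : HasDegree M M' d f) :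
    HasDegree M M'' (d + e) (g ∘ₗ f) := fun i x hx => by
  rw [← add_assoc]
  exact hg _ _ (hf _ _ hx)

theorem HasDegree.isHomogeneous_ker {d : ℤ} {f : M.carrier →ₗ[Rᵐᵒᵖ] M'.carrier}
    (hf : HasDegree M M' d f) : (LinearMap.ker f).IsHomogeneous M.piece :=
  isHomogeneous_iff.2 fun i x hx => by
    rw [LinearMap.mem_ker] at hx ⊢
    rw [← hf.proj_apply, hx, map_zero]

theorem HasDegree.isHomogeneous_range {d : ℤ} {f : M.carrier →ₗ[Rᵐᵒᵖ] M'.carrier}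
    (hf : HasDegree M M' d f) : (LinearMap.range f).IsHomogeneous M'.piece :=
  isHomogeneous_iff.2 fun i => by
    rintro _ ⟨x, rfl⟩
    exact ⟨M.proj (i - d) x, by rw [← hf.proj_apply, sub_add_cancel]⟩

theorem hasDegree_id : HasDegree M M 0 LinearMap.id := fun i x hx => by
  rwa [add_zero]

/-- The degrees of the nonzero components lie in `[-L, L]`. -/
def IsBounded (M : GradedRightModule 𝒜) (L : ℕ) : Prop :=
  ∀ i, M.piece i ≠ ⊥ → |i| ≤ L

theorem IsBounded.eq_zero {L : ℕ} (hM : M.IsBounded L) {i : ℤ} (hi : L < |i|) {x : M.carrier}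
    (hx : x ∈ M.piece i) : x = 0 := by
  have h : M.piece i = ⊥ := by
    by_contra h
    exact absurd (hM i h) (not_le.2 hi)
  rwa [h, AddSubgroup.mem_bot] at hx

theorem isBounded_of_forall {L : ℕ} (h : ∀ i, ∀ x ∈ M.piece i, x ≠ 0 → |i| ≤ L) :
    M.IsBounded L := fun i hi => by
  obtain ⟨x, hx, h0⟩ := (AddSubgroup.bot_or_exists_ne_zero _).resolve_left hi
  exact h i x hx h0

/-- The additive map underlying `component`. -/
noncomputable def componentAddHom (d : ℤ) (f : M.carrier →ₗ[Rᵐᵒᵖ] M'.carrier) :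
    M.carrier →+ M'.carrier :=
  (DirectSum.toAddMonoid fun i =>
    ((M'.proj (i + d)).comp f.toAddMonoidHom).comp (M.piece i).subtype).comp
      (DirectSum.decomposeAddEquiv M.piece).toAddMonoidHom

theorem componentAddHom_apply (d : ℤ) (f : M.carrier →ₗ[Rᵐᵒᵖ] M'.carrier) {i : ℤ} {x : M.carrier}
    (hx : x ∈ M.piece i) : componentAddHom d f x = M'.proj (i + d) (f x) := by
  simp [componentAddHom, DirectSum.decompose_of_mem _ hx]

end HasDegree

section Component

variable [GradedRing 𝒜] {M M' M'' : GradedRightModule 𝒜}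

/-- The component of degree `d` of a linear map between graded modules. -/
noncomputable def component (d : ℤ) (f : M.carrier →ₗ[Rᵐᵒᵖ] M'.carrier) :
    M.carrier →ₗ[Rᵐᵒᵖ] M'.carrier :=
  linearMapOfHomogeneous (𝒜 := 𝒜) (componentAddHom d f) fun j r hr x => by
    induction x using homogeneous_induction with
    | zero => simp
    | homogeneous k x hx =>
      rw [componentAddHom_apply d f hx, componentAddHom_apply d f (M.smul_mem k j x r hx hr),
        map_smul, add_right_comm, proj_smul hr]
    | add x y hx hy => simp [hx, hy]

theorem component_apply (d : ℤ) (f : M.carrier →ₗ[Rᵐᵒᵖ] M'.carrier) {i : ℤ} {x : M.carrier}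
    (hx : x ∈ M.piece i) : component d f x = M'.proj (i + d) (f x) :=
  componentAddHom_apply d f hx

theorem hasDegree_component (d : ℤ) (f : M.carrier →ₗ[Rᵐᵒᵖ] M'.carrier) :
    HasDegree M M' d (component d f) := fun i x hx => by
  rw [component_apply d f hx]
  exact proj_mem _ _

/-- A linear map between graded modules of bounded support is the sum of its components. -/
theorem sum_component {L L' : ℕ} (hM : M.IsBounded L) (hM' : M'.IsBounded L')
    (f : M.carrier →ₗ[Rᵐᵒᵖ] M'.carrier) :
    ∑ d ∈ Finset.Icc (-(L + L' : ℤ)) (L + L'), component d f = f := by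
  ext x
  rw [LinearMap.sum_apply]
  induction x using homogeneous_induction with
  | zero => simp
  | homogeneous i x hx =>
    by_cases hi : (L : ℤ) < |i|
    · simp [hM.eq_zero hi hx]
    have : ∀ d, component d f x = M'.proj (i + d) (f x) := fun d => component_apply d f hx
    simp only [this]
    -- The part of `f x` in degree `k` belongs to `d = k - i`; as `|i| ≤ L` and only `|k| ≤ L'`
    -- matters, such `d` lie in the window.
    have h := sum_proj (M := M') (x := f x)
      (s := (Finset.Icc (-(L + L' : ℤ)) (L + L')).map (addLeftEmbedding i)) (fun k hk => by
        refine hM'.eq_zero ?_ (proj_mem k _)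
        by_contra hk'
        refine hk (Finset.mem_map.2 ⟨k - i, ?_, by simp⟩)
        rw [not_lt, abs_le] at hi hk'
        rw [Finset.mem_Icc]
        omega)
    rw [Finset.sum_map] at h
    exact h
  | add x y hx hy => simp only [map_add, Finset.sum_add_distrib, hx, hy]

theorem component_eq_self {f : M.carrier →ₗ[Rᵐᵒᵖ] M'.carrier} {d : ℤ} (hf : HasDegree M M' d f) :
    component d f = f := by
  ext x
  induction x using homogeneous_induction with
  | zero => simp
  | homogeneous i x hx => rw [component_apply d f hx, proj_eq_self (hf i x hx)]
  | add x y hx hy => simp [hx, hy]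

/-- The degree zero component of a composite. -/
theorem component_zero_comp {L L' : ℕ} (hM : M.IsBounded L) (hM' : M'.IsBounded L')
    (f : M.carrier →ₗ[Rᵐᵒᵖ] M'.carrier) (g : M'.carrier →ₗ[Rᵐᵒᵖ] M''.carrier) :
    component 0 (g ∘ₗ f) =
      ∑ d ∈ Finset.Icc (-(L + L' : ℤ)) (L + L'), component (-d) g ∘ₗ component d f := by
  ext x
  induction x using homogeneous_induction with
  | zero => simp
  | homogeneous i x hx =>
    rw [component_apply 0 _ hx, LinearMap.sum_apply, LinearMap.comp_apply]
    conv_lhs => rw [← sum_component hM hM' f, LinearMap.sum_apply, map_sum, map_sum]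
    refine Finset.sum_congr rfl fun d _ => ?_
    rw [LinearMap.comp_apply, component_apply _ g (hasDegree_component d f i x hx)]
    congr 2
    ring
  | add x y hx hy => simp only [map_add, hx, hy]

end Component

/-! ### Harada–Sai lemma and nilpotence. -/

section HaradaSai

open scoped Pointwise

variable {M : GradedRightModule 𝒜}

/-- The homogeneous endomorphisms of a graded module which are not bijective. -/
def homogeneousNonIso (M : GradedRightModule 𝒜) : Set (Module.End Rᵐᵒᵖ M.carrier) :=
  {f | (∃ d, HasDegree M M d f) ∧ ¬ Function.Bijective f}

theorem exists_hasDegree_of_mem_pow {n : ℕ} {f : Module.End Rᵐᵒᵖ M.carrier}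
    (hf : f ∈ M.homogeneousNonIso ^ n) : ∃ d, HasDegree M M d f := by
  induction n generalizing f with
  | zero =>
    rw [pow_zero, Set.mem_one] at hf
    exact ⟨0, hf ▸ hasDegree_id⟩
  | succ n ih =>
    rw [pow_succ] at hf
    obtain ⟨g, hg, h, ⟨⟨e, he⟩, -⟩, rfl⟩ := Set.mem_mul.1 hf
    obtain ⟨d, hd⟩ := ih hg
    exact ⟨_, hd.comp he⟩

/-- An endomorphism of nonzero degree of a nonzero graded module of bounded support is not
bijective. -/
theorem HasDegree.mem_homogeneousNonIso [Nontrivial M.carrier] {L : ℕ} (hL : M.IsBounded L) {d : ℤ}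
    (hd : d ≠ 0) {f : Module.End Rᵐᵒᵖ M.carrier} (hf : HasDegree M M d f) :
    f ∈ M.homogeneousNonIso := by
  refine ⟨⟨d, hf⟩, fun hb => ?_⟩
  obtain ⟨x, hx⟩ := exists_ne (0 : M.carrier)
  obtain ⟨i, hi⟩ : ∃ i, M.proj i x ≠ 0 := by
    by_contra! h
    exact hx (ext_proj fun i => by simp [h])
  have key : ∀ m : ℕ, (f ^ m) (M.proj i x) ∈ M.piece (i + m * d) := by
    intro m
    induction m with
    | zero => simpa using proj_mem i x
    | succ m ih =>
      rw [pow_succ']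
      have h : i + ((m + 1 : ℕ) : ℤ) * d = i + m * d + d := by push_cast; ring
      rw [h]
      exact hf _ _ ih
  have hinj : ∀ m : ℕ, (f ^ m) (M.proj i x) ≠ 0 := by
    intro m hm
    have : Function.Injective (f ^ m) := by
      rw [Module.End.coe_pow]
      exact hb.1.iterate m
    exact hi (this (by rw [hm, map_zero]))
  -- Starting from a degree in `[-L, L]`, `2 * L + 1` shifts by `d ≠ 0` leave this interval.
  refine hinj (2 * L + 1) (hL.eq_zero ?_ (key _))
  by_contra! hcon
  have hi' : |i| ≤ L := by
    by_contra! h'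
    exact hi (hL.eq_zero h' (proj_mem i x))
  rw [abs_le] at hcon hi'
  push_cast at hcon
  rcases lt_or_gt_of_ne hd with h | h <;> nlinarith

/-- The rightmost factor is already not injective, since injective endomorphisms of artinian modules
are bijective. -/
theorem not_injective_of_mem_pow [IsArtinian Rᵐᵒᵖ M.carrier] {n : ℕ} {f : Module.End Rᵐᵒᵖ M.carrier}
    (hf : f ∈ M.homogeneousNonIso ^ (n + 1)) : ¬ Function.Injective f := by
  rw [pow_succ] at hf
  obtain ⟨g, -, h, ⟨-, hh⟩, rfl⟩ := Set.mem_mul.1 hf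
  intro hinj
  exact hh (IsArtinian.bijective_of_injective_endomorphism h
    (Function.Injective.of_comp (f := g) hinj))

variable [IsArtinian Rᵐᵒᵖ M.carrier] [IsNoetherian Rᵐᵒᵖ M.carrier]

/-- **Harada–Sai lemma** for the homogeneous endomorphisms of an indecomposable graded module: a
product of `2 ^ k` non-isomorphisms is zero or has an image of colength more than `k`. -/
theorem length_range_of_mem_pow (hM : M.IsIndecomposable) {k : ℕ} {f : Module.End Rᵐᵒᵖ M.carrier}
    (hf : f ∈ M.homogeneousNonIso ^ (2 ^ k)) :
    f = 0 ∨ Module.length Rᵐᵒᵖ (LinearMap.range f) + (k + 1 : ℕ) ≤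
      Module.length Rᵐᵒᵖ M.carrier := by
  induction k generalizing f with
  | zero =>
    right
    have hsurj : LinearMap.range f ≠ ⊤ := fun h =>
      not_injective_of_mem_pow (n := 0) (by simpa using hf)
        (IsNoetherian.injective_of_surjective_endomorphism f (LinearMap.range_eq_top.1 h))
    simpa using Order.add_one_le_of_lt (Submodule.length_lt hsurj)
  | succ k ih =>
    rw [pow_succ, mul_two, pow_add] at hf
    obtain ⟨h, hh, g, hg, rfl⟩ := Set.mem_mul.1 hf
    by_contra! hcon
    obtain ⟨hne, hlt⟩ := hcon
    have h0 : h ≠ 0 := fun h0 => hne (by simp [h0])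
    have g0 : g ≠ 0 := fun g0 => hne (by simp [g0])
    have lh := (ih hh).resolve_left h0
    have lg := (ih hg).resolve_left g0
    have hle : LinearMap.range (h * g) ≤ LinearMap.range h := LinearMap.range_comp_le_range g h
    have hfin : ∀ N : Submodule Rᵐᵒᵖ M.carrier, Module.length Rᵐᵒᵖ N ≠ ⊤ :=
      fun N => Module.length_ne_top
    have hn : Module.length Rᵐᵒᵖ M.carrier ≠ ⊤ := Module.length_ne_top
    have hmap : Module.length Rᵐᵒᵖ (LinearMap.range g) =
        Module.length Rᵐᵒᵖ (LinearMap.ker (h.domRestrict (LinearMap.range g))) +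
          Module.length Rᵐᵒᵖ (LinearMap.range (h * g)) := by
      have hr : LinearMap.range (h * g) = LinearMap.range (h.domRestrict (LinearMap.range g)) := by
        rw [LinearMap.range_domRestrict]
        exact LinearMap.range_comp g h
      rw [hr]
      exact Module.length_eq_add_of_exact
        (LinearMap.ker (h.domRestrict (LinearMap.range g))).subtype
        (h.domRestrict (LinearMap.range g)).rangeRestrict
        (Submodule.injective_subtype _) (LinearMap.surjective_rangeRestrict _)
        (by rw [LinearMap.exact_iff]; simp)
    have hlen : Module.length Rᵐᵒᵖ (LinearMap.range (h * g)) ≤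
        Module.length Rᵐᵒᵖ (LinearMap.range h) := by
      simpa only [Module.length_submodule] using Order.height_mono hle
    have f1 := hfin (LinearMap.range (h * g))
    have f2 := hfin (LinearMap.range h)
    have f3 := hfin (LinearMap.range g)
    have f4 : Module.length Rᵐᵒᵖ (LinearMap.ker (h.domRestrict (LinearMap.range g))) ≠ ⊤ :=
      Module.length_ne_top
    -- If the colength did not grow, the ranges of `h * g`, `h` and `g` would all have the same
    -- length. This makes `ker h` and `range g` complementary homogeneous submodules, so one of them
    -- is zero; neither can be.
    have hnums : Module.length Rᵐᵒᵖ (LinearMap.range (h * g)) =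
          Module.length Rᵐᵒᵖ (LinearMap.range h) ∧
        Module.length Rᵐᵒᵖ (LinearMap.ker (h.domRestrict (LinearMap.range g))) = 0 := by
      generalize Module.length Rᵐᵒᵖ (LinearMap.range (h * g)) = a at *
      generalize Module.length Rᵐᵒᵖ (LinearMap.range h) = b at *
      generalize Module.length Rᵐᵒᵖ (LinearMap.range g) = c at *
      generalize Module.length Rᵐᵒᵖ (LinearMap.ker (h.domRestrict (LinearMap.range g))) = d at *
      generalize Module.length Rᵐᵒᵖ M.carrier = n at *
      lift a to ℕ using f1
      lift b to ℕ using f2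
      lift c to ℕ using f3
      lift d to ℕ using f4
      lift n to ℕ using hn
      norm_cast at *
      omega
    have hrange : LinearMap.range (h * g) = LinearMap.range h := by
      by_contra hne'
      have := Submodule.height_strictMono (lt_of_le_of_ne hle hne')
      rw [← Module.length_submodule, ← Module.length_submodule, hnums.1] at this
      exact lt_irrefl _ this
    have hcompl : IsCompl (LinearMap.ker h) (LinearMap.range g) := by
      refine ⟨Submodule.disjoint_def.2 fun x hx hxg => ?_, codisjoint_iff.2 (eq_top_iff.2 ?_)⟩
      · have hsub := Module.length_eq_zero_iff.1 hnums.2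
        have hmem : (⟨x, hxg⟩ : LinearMap.range g) ∈
            LinearMap.ker (h.domRestrict (LinearMap.range g)) := hx
        have := congrArg Subtype.val (Subsingleton.elim
          (⟨_, hmem⟩ : LinearMap.ker (h.domRestrict (LinearMap.range g))) 0)
        exact congrArg Subtype.val this
      · intro x _
        obtain ⟨y, hy⟩ : h x ∈ LinearMap.range (h * g) := hrange ▸ LinearMap.mem_range_self h x
        refine Submodule.mem_sup.2 ⟨x - g y, ?_, g y, LinearMap.mem_range_self g y, by simp⟩
        rw [LinearMap.mem_ker, map_sub, ← hy]
        exact sub_self _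
    obtain ⟨d, hd⟩ := exists_hasDegree_of_mem_pow hh
    obtain ⟨e, he⟩ := exists_hasDegree_of_mem_pow hg
    rcases hM.2 _ _ hd.isHomogeneous_ker he.isHomogeneous_range hcompl with h1 | h1
    · obtain ⟨m, hm⟩ := Nat.exists_eq_succ_of_ne_zero (pow_ne_zero k (two_ne_zero (α := ℕ)))
      rw [hm] at hh
      exact not_injective_of_mem_pow hh (LinearMap.ker_eq_bot.1 h1)
    · exact g0 (LinearMap.range_eq_bot.1 h1)

/-- Sums of homogeneous non-isomorphisms of an indecomposable graded module are nilpotent. -/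
theorem isNilpotent_of_mem_span (hM : M.IsIndecomposable) {f : Module.End Rᵐᵒᵖ M.carrier}
    (hf : f ∈ Submodule.span ℤ M.homogeneousNonIso) : IsNilpotent f := by
  obtain ⟨n, hn⟩ := ENat.ne_top_iff_exists.1
    (Module.length_ne_top : Module.length Rᵐᵒᵖ M.carrier ≠ ⊤)
  refine ⟨2 ^ n, ?_⟩
  have h := Submodule.pow_mem_pow _ hf (2 ^ n)
  rw [Submodule.span_pow] at h
  have hbot : Submodule.span ℤ (M.homogeneousNonIso ^ (2 ^ n)) = ⊥ :=
    Submodule.span_eq_bot.2 fun g hg => by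
      refine (length_range_of_mem_pow hM hg).resolve_right fun hle => ?_
      rw [← hn] at hle
      have := le_add_self.trans hle
      norm_cast at this
      omega
  rwa [hbot, Submodule.mem_bot] at h

end HaradaSai

/-! ### Comparison of graded lengths. -/

section GradedLength

variable {M M' : GradedRightModule 𝒜}

theorem HasDegree.gradedLength_le {d : ℤ} {f : M.carrier →ₗ[Rᵐᵒᵖ] M'.carrier}
    (hf : HasDegree M M' d f) (hinj : Function.Injective f) : M.gradedLength ≤ M'.gradedLength := by
  have key : ∀ i, M.piece i ≠ ⊥ → M'.piece (i + d) ≠ ⊥ := by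
    intro i hi h
    obtain ⟨x, hx, h0⟩ := (AddSubgroup.bot_or_exists_ne_zero _).resolve_left hi
    have := hf i x hx
    rw [h, AddSubgroup.mem_bot] at this
    exact h0 (hinj (by rw [this, map_zero]))
  unfold gradedLength
  refine iSup_le fun i => iSup_le fun j => iSup_le fun hij => iSup_le fun hi => iSup_le fun hj => ?_
  refine le_iSup_of_le (i + d) (le_iSup_of_le (j + d) (le_iSup_of_le (by omega)
    (le_iSup_of_le (key i hi) (le_iSup_of_le (key j hj) ?_))))
  rw [add_sub_add_right_eq_sub]

theorem IsBounded.gradedLength_lt_top {L : ℕ} (hL : M.IsBounded L) : M.gradedLength < ⊤ := by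
  refine lt_of_le_of_lt ?_ (ENat.natCast_lt_top (2 * L + 1))
  unfold gradedLength
  refine iSup_le fun i => iSup_le fun j => iSup_le fun hij => iSup_le fun hi => iSup_le fun hj => ?_
  have h1 := abs_le.1 (hL i hi)
  have h2 := abs_le.1 (hL j hj)
  exact_mod_cast (by omega : (j - i).toNat + 1 ≤ 2 * L + 1)

end GradedLength

/-! ### Modules underlying indecomposable graded modules. -/

section Indecomposable

variable [GradedRing 𝒜] {M M' : GradedRightModule 𝒜}

/-- The remaining components have nonzero degree, so bounded support prevents them from being
bijective. -/
theorem sub_component_zero_mem_span [Nontrivial M.carrier] {L : ℕ} (hL : M.IsBounded L)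
    (f : Module.End Rᵐᵒᵖ M.carrier) :
    f - component 0 f ∈ Submodule.span ℤ M.homogeneousNonIso := by
  have h0 : (0 : ℤ) ∈ Finset.Icc (-(L + L : ℤ)) (L + L) := by
    rw [Finset.mem_Icc]; omega
  have h := sum_component hL hL f
  rw [← Finset.add_sum_erase _ _ h0] at h
  have h' : f - component 0 f =
      ∑ d ∈ (Finset.Icc (-(L + L : ℤ)) (L + L)).erase 0, component d f := by
    rw [sub_eq_iff_eq_add', h]
  rw [h']
  exact Submodule.sum_mem _ fun d hd => Submodule.subset_span
    ((hasDegree_component d f).mem_homogeneousNonIso hL (Finset.ne_of_mem_erase hd))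

variable [IsArtinian Rᵐᵒᵖ M.carrier] [IsNoetherian Rᵐᵒᵖ M.carrier]

/-- An endomorphism of an indecomposable graded module whose component of degree zero is the
identity is bijective. -/
theorem isUnit_of_component_zero_eq_one (hM : M.IsIndecomposable) {L : ℕ} (hL : M.IsBounded L)
    {f : Module.End Rᵐᵒᵖ M.carrier} (hf : component 0 f = LinearMap.id) : IsUnit f := by
  have := hM.1
  have h := isNilpotent_of_mem_span hM (sub_component_zero_mem_span hL f)
  rw [hf] at h
  simpa [Module.End.one_eq_id] using h.isUnit_add_one

/-- Here every component of `e` is a homogeneous non-isomorphism, so `e` is nilpotent as well as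
idempotent. -/
theorem eq_zero_of_isIdempotentElem (hM : M.IsIndecomposable) {L : ℕ} (hL : M.IsBounded L)
    {e : Module.End Rᵐᵒᵖ M.carrier} (he : IsIdempotentElem e)
    (h0 : ¬ Function.Bijective (component 0 e)) : e = 0 := by
  have := hM.1
  have h := Submodule.add_mem _ (sub_component_zero_mem_span hL e)
    (Submodule.subset_span ⟨⟨0, hasDegree_component 0 e⟩, h0⟩)
  rw [sub_add_cancel] at h
  obtain ⟨n, hn⟩ := isNilpotent_of_mem_span hM h
  have h1 : e ^ (n + 1) = 0 := by rw [pow_succ, hn, zero_mul]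
  rwa [he.pow_succ_eq] at h1

/-- The module underlying an indecomposable graded module of finite length and bounded support is
indecomposable. -/
theorem IsIndecomposable.isIndecomposableModule (hM : M.IsIndecomposable) {L : ℕ}
    (hL : M.IsBounded L) : IsIndecomposableModule Rᵐᵒᵖ M.carrier := by
  have := hM.1
  refine ⟨hM.1, fun N N' hN => ?_⟩
  set e : Module.End Rᵐᵒᵖ M.carrier := N.projection N' hN
  have he : IsIdempotentElem e := Submodule.isIdempotentElem_projection hN
  have hrange : LinearMap.range e = N := Submodule.range_projection hN
  have hker : LinearMap.ker e = N' := Submodule.ker_projection hN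
  by_cases h0 : Function.Bijective (component 0 e)
  · by_cases h1 : Function.Bijective (component 0 (1 - e))
    · exfalso
      have hsub : component 0 (1 - e) = 1 - component 0 e := by
        ext x
        induction x using homogeneous_induction with
        | zero => simp
        | homogeneous i x hx =>
          rw [component_apply 0 _ hx, LinearMap.sub_apply, LinearMap.sub_apply,
            component_apply 0 _ hx, map_sub]
          simp [proj_eq_self hx]
        | add x y hx hy => simp only [map_add, hx, hy]
      -- The degree zero part of `e * e = e` gives `e₀ (1 - e₀) = ∑ e₋ₔ eₔ` over `d ≠ 0`. Each `eₔ`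
      -- is not injective, so the sum is nilpotent, whereas both factors on the left are units.
      have hmem : component 0 e * (1 - component 0 e) ∈
          Submodule.span ℤ M.homogeneousNonIso := by
        have h := component_zero_comp hL hL e e
        have h0' : (0 : ℤ) ∈ Finset.Icc (-(L + L : ℤ)) (L + L) := by
          rw [Finset.mem_Icc]; omega
        rw [← Module.End.mul_eq_comp, he.eq, ← Finset.add_sum_erase _ _ h0', neg_zero,
          ← Module.End.mul_eq_comp] at h
        have h' : component 0 e * (1 - component 0 e) =
            ∑ d ∈ (Finset.Icc (-(L + L : ℤ)) (L + L)).erase 0,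
              component (-d) e ∘ₗ component d e := by
          rw [mul_sub, mul_one, sub_eq_iff_eq_add']
          exact h
        rw [h']
        refine Submodule.sum_mem _ fun d hd => Submodule.subset_span
          ⟨⟨_, (hasDegree_component (-d) e).comp (hasDegree_component d e)⟩, fun hb => ?_⟩
        exact ((hasDegree_component d e).mem_homogeneousNonIso hL (Finset.ne_of_mem_erase hd)).2
          (IsArtinian.bijective_of_injective_endomorphism _
            (Function.Injective.of_comp (f := component (-d) e) hb.1))
      refine (isNilpotent_of_mem_span hM hmem).not_isUnit ?_
      rw [hsub] at h1
      exact ((Module.End.isUnit_iff _).2 h0).mul ((Module.End.isUnit_iff _).2 h1)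
    · right
      have h := eq_zero_of_isIdempotentElem hM hL he.one_sub h1
      rw [sub_eq_zero] at h
      rw [← hker, ← h]
      exact LinearMap.ker_id
  · left
    rw [← hrange, eq_zero_of_isIdempotentElem hM hL he h0, LinearMap.range_zero]

/-- If the modules underlying two graded modules of bounded support are isomorphic and the first is
indecomposable, then some component of the isomorphism is injective. -/
theorem exists_injective_component (hM : M.IsIndecomposable) {L L' : ℕ} (hL : M.IsBounded L)
    (hL' : M'.IsBounded L') (φ : M.carrier ≃ₗ[Rᵐᵒᵖ] M'.carrier) :
    ∃ d, Function.Injective (component d φ.toLinearMap) := by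
  have := hM.1
  by_contra! hcon
  have h := component_zero_comp hL hL' φ.toLinearMap φ.symm.toLinearMap
  rw [LinearEquiv.symm_comp, component_eq_self hasDegree_id] at h
  -- The identity is the sum of the composites of the degree `d` part of `φ` with the degree `-d`
  -- part of its inverse. Were no part of `φ` injective, it would be nilpotent.
  have hmem : (LinearMap.id : Module.End Rᵐᵒᵖ M.carrier) ∈
      Submodule.span ℤ M.homogeneousNonIso := by
    rw [h]
    refine Submodule.sum_mem _ fun d _ => Submodule.subset_span
      ⟨⟨_, (hasDegree_component (-d) _).comp (hasDegree_component d _)⟩, fun hb => ?_⟩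
    exact hcon d (Function.Injective.of_comp (f := component (-d) φ.symm.toLinearMap) hb.1)
  exact (isNilpotent_of_mem_span hM hmem).not_isUnit isUnit_one

end Indecomposable

/-! ### Boundedness of the support. -/

section Support

variable {M : GradedRightModule 𝒜}

theorem exists_proj_add_mul_eq_zero (x : M.carrier) (k : ℤ) {d : ℤ} (hd : d ≠ 0) :
    ∃ m : ℕ, M.proj (k + m * d) x = 0 := by
  obtain ⟨s, hs, -⟩ := exists_sum_proj x
  have hinj : Function.Injective fun m : ℕ => k + m * d := fun a b h => by
    simpa [hd] using h
  obtain ⟨_, ⟨m, rfl⟩, hm⟩ := (Set.infinite_range_of_injective hinj).exists_notMem_finset s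
  exact ⟨m, hs _ hm⟩

/-- A simple graded module which is artinian as a module has no nonzero endomorphism of nonzero
degree: otherwise `1 - f` would be injective but not surjective. -/
theorem HasDegree.eq_zero_of_simple [IsArtinian Rᵐᵒᵖ M.carrier]
    (hM : ∀ N : Submodule Rᵐᵒᵖ M.carrier, N.IsHomogeneous M.piece → N = ⊥ ∨ N = ⊤) {d : ℤ}
    (hd : d ≠ 0) {f : Module.End Rᵐᵒᵖ M.carrier} (hf : HasDegree M M d f) : f = 0 := by
  by_contra hf0
  have hinj : Function.Injective f := LinearMap.ker_eq_bot.1 <|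
    (hM _ hf.isHomogeneous_ker).resolve_right fun h => hf0 (LinearMap.ker_eq_top.1 h)
  have hpow : ∀ m : ℕ, Function.Injective (f ^ m) := fun m => by
    rw [Module.End.coe_pow]
    exact hinj.iterate m
  have hproj : ∀ k x, M.proj k (f x) = f (M.proj (k - d) x) := fun k x => by
    rw [← hf.proj_apply, sub_add_cancel]
  have hback : ∀ k x, (∀ m : ℕ, M.proj (k + m * -d) x = f (M.proj (k + (m + 1 : ℕ) * -d) x)) →
      M.proj k x = 0 := by
    intro k x h
    have hm : ∀ m : ℕ, M.proj k x = (f ^ m) (M.proj (k + m * -d) x) := by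
      intro m
      induction m with
      | zero => simp
      | succ m ih => rw [ih, pow_succ, Module.End.mul_apply, h]
    obtain ⟨m, h0⟩ := exists_proj_add_mul_eq_zero x k (neg_ne_zero.2 hd)
    rw [hm m, h0, map_zero]
  -- A fixed point of `f` has `k`-th component `f ^ m` of its component in degree `k - m * d`, which
  -- is zero for some `m`.
  have hsurj : Function.Surjective (1 - f : Module.End Rᵐᵒᵖ M.carrier) := by
    refine IsArtinian.surjective_of_injective_endomorphism _ (LinearMap.ker_eq_bot.1 ?_)
    refine (Submodule.eq_bot_iff _).2 fun x hx => ext_proj fun k => ?_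
    have hx' : x = f x := by simpa [sub_eq_zero] using hx
    rw [map_zero]
    refine hback k x fun m => ?_
    conv_lhs => rw [hx', hproj]
    congr 2
    push_cast
    ring_nf
  obtain ⟨y, hy⟩ : ∃ y : M.carrier, y ≠ 0 := by
    by_contra! h
    exact hf0 (LinearMap.ext fun x => h _)
  obtain ⟨i, hi⟩ : ∃ i, M.proj i y ≠ 0 := by
    by_contra! h
    exact hy (ext_proj fun i => by simp [h])
  obtain ⟨x, hx⟩ := hsurj (M.proj i y)
  have hx' : ∀ k, M.proj k (M.proj i y) = M.proj k x - f (M.proj (k - d) x) := fun k => by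
    rw [← hx, ← hproj]
    simp
  have hrec : ∀ k, k ≠ i → M.proj k x = f (M.proj (k - d) x) := fun k hk => by
    rw [← sub_eq_zero, ← hx', proj_eq_zero (proj_mem i y) hk.symm]
  have hne : ∀ m : ℕ, ((m + 1 : ℕ) : ℤ) * d ≠ 0 := fun m =>
    mul_ne_zero (by exact_mod_cast m.succ_ne_zero) hd
  -- With `x - f x` homogeneous of degree `i`, the recursion `hrec` pushes the components at `i` and
  -- `i - d` along infinite progressions, upwards and downwards. Finite support kills both,
  -- contradicting `hi`.
  have h1 : M.proj i x = 0 := by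
    have hm : ∀ m : ℕ, M.proj (i + m * d) x = (f ^ m) (M.proj i x) := by
      intro m
      induction m with
      | zero => simp
      | succ m ih =>
        rw [pow_succ', Module.End.mul_apply, ← ih, hrec _ (by have := hne m; omega)]
        congr 2
        push_cast
        ring_nf
    obtain ⟨m, h0⟩ := exists_proj_add_mul_eq_zero x i hd
    exact hpow m (by rw [← hm, h0, map_zero])
  have h2 : M.proj (i - d) x = 0 := hback _ _ fun m => by
    rw [hrec]
    · congr 2
      push_cast
      ring_nf
    · have := hne m
      push_cast at this
      intro h
      apply this
      linarith
  apply hi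
  have := hx' i
  rwa [h1, h2, map_zero, sub_zero, proj_eq_self (proj_mem i y)] at this

/-- Used to see that annihilators and spans of homogeneous elements are homogeneous. -/
theorem proj_smul_of_mem [GradedRing 𝒜] {i : ℤ} {x : M.carrier} (hx : x ∈ M.piece i) (r : R)
    (k : ℤ) : M.proj (i + k) (MulOpposite.op r • x) =
      MulOpposite.op (DirectSum.decompose 𝒜 r k : R) • x := by
  induction r using ring_induction (𝒜 := 𝒜) with
  | zero => simp
  | homogeneous j r hr =>
    by_cases h : j = k
    · subst h
      rw [DirectSum.decompose_of_mem_same 𝒜 hr, proj_smul hr, proj_eq_self hx]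
    · rw [DirectSum.decompose_of_mem_ne 𝒜 hr h, MulOpposite.op_zero, zero_smul]
      exact proj_eq_zero (M.smul_mem i j x r hx hr) (by omega)
  | add r s hr hs => simp [add_smul, hr, hs]

/-- A simple graded module over an artinian graded ring has bounded support. -/
theorem exists_isBounded_of_simple [GradedRing 𝒜] [IsArtinianRing Rᵐᵒᵖ]
    [IsArtinian Rᵐᵒᵖ M.carrier]
    (hM : ∀ N : Submodule Rᵐᵒᵖ M.carrier, N.IsHomogeneous M.piece → N = ⊥ ∨ N = ⊤) :
    ∃ L, M.IsBounded L := by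
  classical
  by_contra! hcon
  set I : Set ℤ := {i | M.piece i ≠ ⊥} with hI
  have hinf : ∀ F : Finset ℤ, ∃ i ∈ I, i ∉ F := by
    intro F
    by_contra! h
    refine hcon (F.sup Int.natAbs) fun i hi => ?_
    rw [Int.abs_eq_natAbs]
    exact_mod_cast Finset.le_sup (f := Int.natAbs) (h i hi)
  have hex : ∀ i, ∃ x ∈ M.piece i, i ∈ I → x ≠ 0 := by
    intro i
    by_cases h : i ∈ I
    · obtain ⟨x, hx, h0⟩ := (AddSubgroup.bot_or_exists_ne_zero _).resolve_left h
      exact ⟨x, hx, fun _ => h0⟩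
    · exact ⟨0, zero_mem _, fun h' => absurd h' h⟩
  choose x hx hx0 using hex
  set ann : ℤ → Submodule Rᵐᵒᵖ Rᵐᵒᵖ := fun i =>
    LinearMap.ker (LinearMap.toSpanSingleton Rᵐᵒᵖ M.carrier (x i)) with hann
  have mem_ann : ∀ i a, a ∈ ann i ↔ a • x i = 0 := fun i a => by simp [hann]
  set A : Finset ℤ → Submodule Rᵐᵒᵖ Rᵐᵒᵖ := fun F => F.inf ann with hA
  have mem_A : ∀ F a, a ∈ A F ↔ ∀ i ∈ F, a • x i = 0 := fun F a => by
    simp only [hA, Submodule.mem_finsetInf, mem_ann]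
  -- By artinianity, a finite intersection of annihilators of the `x i` is minimal, hence is
  -- contained in `ann j` for some further `j` in the support.
  obtain ⟨_, ⟨F₀, rfl⟩, hmin⟩ :=
    (wellFounded_lt (α := Submodule Rᵐᵒᵖ Rᵐᵒᵖ)).has_min (Set.range A) ⟨_, ∅, rfl⟩
  obtain ⟨j, hjI, hj⟩ := hinf F₀
  have hF₀ : A F₀ ≤ ann j := by
    have hle : A (insert j F₀) ≤ A F₀ := Finset.inf_mono (Finset.subset_insert j F₀)
    have : A (insert j F₀) = A F₀ := by
      by_contra h
      exact hmin _ ⟨_, rfl⟩ (lt_of_le_of_ne hle h)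
    rw [← this]
    exact Finset.inf_le (Finset.mem_insert_self j F₀)
  -- For minimal `F` and `i ∈ F`, the ideal `B` of `F` without `i` does not kill `x j`, but its
  -- elements that kill `x i` do. So `a • x i ↦ a • x j` for `a ∈ B` is well defined, nonzero and of
  -- degree `j - i`.
  obtain ⟨F, ⟨hjF, hF⟩, hFmin⟩ := (wellFounded_lt (α := Finset ℤ)).has_min
    {F | j ∉ F ∧ A F ≤ ann j} ⟨F₀, hj, hF₀⟩
  obtain ⟨i, hi⟩ : F.Nonempty := by
    rw [Finset.nonempty_iff_ne_empty]
    rintro rfl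
    have := hF (show (1 : Rᵐᵒᵖ) ∈ A ∅ by simp [mem_A])
    rw [mem_ann, one_smul] at this
    exact hx0 j hjI this
  have hij : j - i ≠ 0 := by
    rw [sub_ne_zero]
    rintro rfl
    exact hjF hi
  set B := A (F.erase i) with hB
  have hBj : ¬ B ≤ ann j := fun h =>
    hFmin (F.erase i) ⟨fun hj => hjF (Finset.mem_of_mem_erase hj), h⟩ (Finset.erase_ssubset hi)
  have hBi : ∀ a ∈ B, a • x i = 0 → a • x j = 0 := fun a ha hai => by
    rw [← mem_ann]
    refine hF ((mem_A _ _).2 fun k hk => ?_)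
    by_cases h : k = i
    · rw [h, hai]
    · exact (mem_A _ _).1 ha k (Finset.mem_erase.2 ⟨h, hk⟩)
  have hBhom : ∀ r : R, MulOpposite.op r ∈ B → ∀ k,
      MulOpposite.op (DirectSum.decompose 𝒜 r k : R) ∈ B := fun r hr k =>
    (mem_A _ _).2 fun l hl => by
      rw [← proj_smul_of_mem (hx l), (mem_A _ _).1 hr l hl, map_zero]
  set gi := (LinearMap.toSpanSingleton Rᵐᵒᵖ M.carrier (x i)).domRestrict B with hgi
  set gj := (LinearMap.toSpanSingleton Rᵐᵒᵖ M.carrier (x j)).domRestrict B with hgj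
  have gi_apply : ∀ a : B, gi a = a.1 • x i := fun a => rfl
  have gj_apply : ∀ a : B, gj a = a.1 • x j := fun a => rfl
  have hsurj : LinearMap.range gi = ⊤ := by
    refine (hM _ (isHomogeneous_iff.2 ?_)).resolve_left fun h => hBj fun a ha => ?_
    · rintro k _ ⟨⟨a, ha⟩, rfl⟩
      obtain ⟨r, rfl⟩ := MulOpposite.op_surjective a
      refine ⟨⟨_, hBhom r ha (k - i)⟩, ?_⟩
      rw [gi_apply, gi_apply, ← proj_smul_of_mem (hx i), add_sub_cancel]
    · rw [mem_ann]
      exact hBi a ha (DFunLike.congr_fun (LinearMap.range_eq_bot.1 h) (⟨a, ha⟩ : B))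
  have hker : LinearMap.ker gi ≤ LinearMap.ker gj := fun a ha => hBi a.1 a.2 ha
  set f : Module.End Rᵐᵒᵖ M.carrier := (LinearMap.ker gi).liftQ gj hker ∘ₗ
    (gi.quotKerEquivOfSurjective (LinearMap.range_eq_top.1 hsurj)).symm.toLinearMap with hf
  have hfg : ∀ a, f (gi a) = gj a := fun a => by
    have : (gi.quotKerEquivOfSurjective (LinearMap.range_eq_top.1 hsurj)).symm (gi a) =
        Submodule.Quotient.mk a := by
      rw [LinearEquiv.symm_apply_eq]
      rfl
    simp [hf, this]
  have hdeg : HasDegree M M (j - i) f := by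
    intro k y hy
    obtain ⟨⟨a, ha⟩, rfl⟩ := LinearMap.range_eq_top.1 hsurj y
    obtain ⟨r, rfl⟩ := MulOpposite.op_surjective a
    have : gi ⟨_, ha⟩ = gi ⟨_, hBhom r ha (k - i)⟩ := by
      rw [← proj_eq_self hy, gi_apply, gi_apply, ← proj_smul_of_mem (hx i), add_sub_cancel]
    rw [this, hfg, gj_apply]
    have h := M.smul_mem j (k - i) (x j) _ (hx j) (DirectSum.decompose 𝒜 r (k - i)).2
    convert h using 2
    ring
  have hf0 := hdeg.eq_zero_of_simple hM hij
  refine hBj fun a ha => (mem_ann _ _).2 ?_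
  rw [← gj_apply ⟨a, ha⟩, ← hfg, hf0, LinearMap.zero_apply]

theorem isHomogeneous_map_subIncl {N : Submodule Rᵐᵒᵖ M.carrier} {hN : N.IsHomogeneous M.piece}
    {W : Submodule Rᵐᵒᵖ (M.sub N hN).carrier} (hW : W.IsHomogeneous (M.sub N hN).piece) :
    (W.map (M.subIncl N hN)).IsHomogeneous M.piece :=
  isHomogeneous_iff.2 fun i => by
    rintro _ ⟨x, hx, rfl⟩
    exact ⟨_, hW i hx, subIncl_proj M i x⟩

/-- A graded module of finite length over an artinian graded ring has bounded support. -/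
theorem exists_isBounded [GradedRing 𝒜] [IsArtinianRing Rᵐᵒᵖ] (M : GradedRightModule 𝒜)
    [IsArtinian Rᵐᵒᵖ M.carrier] [IsNoetherian Rᵐᵒᵖ M.carrier] : ∃ L, M.IsBounded L := by
  -- `T` is a maximal homogeneous submodule of bounded support. If it were proper, a minimal nonzero
  -- homogeneous submodule of `M / T` would have bounded support, and its preimage would be larger
  -- than `T`.
  obtain ⟨T, ⟨hT, L, hL⟩, hmax⟩ :=
    (wellFounded_gt (α := Submodule Rᵐᵒᵖ M.carrier)).has_min
    {N | N.IsHomogeneous M.piece ∧ ∃ L : ℕ, ∀ i, ∀ x ∈ N, x ∈ M.piece i → x ≠ 0 → |i| ≤ L}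
    ⟨⊥, isHomogeneous_iff.2 fun i x hx => by simp_all, 0, fun i x hx _ h0 => absurd hx h0⟩
  by_cases hTtop : T = ⊤
  · exact ⟨L, isBounded_of_forall fun i x hx h0 => hL i x (hTtop ▸ Submodule.mem_top) hx h0⟩
  exfalso
  set Q := M.quotient T hT
  have : IsArtinian Rᵐᵒᵖ Q.carrier :=
    isArtinian_of_surjective _ (M.quotientMk T hT) (quotientMk_surjective M)
  have hQ : (⊤ : Submodule Rᵐᵒᵖ Q.carrier) ≠ ⊥ := fun h => hTtop <| by
    rw [← ker_quotientMk (hN := hT) M, LinearMap.ker_eq_top]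
    ext x
    exact (Submodule.mem_bot Rᵐᵒᵖ).1 (h ▸ Submodule.mem_top)
  obtain ⟨W, ⟨hW, hW0⟩, hmin⟩ := (wellFounded_lt (α := Submodule Rᵐᵒᵖ Q.carrier)).has_min
    {N | N.IsHomogeneous Q.piece ∧ N ≠ ⊥} ⟨⊤, isHomogeneous_iff.2 fun _ _ _ => trivial, hQ⟩
  have : IsArtinian Rᵐᵒᵖ (Q.sub W hW).carrier :=
    isArtinian_of_injective _ (subIncl_injective Q)
  obtain ⟨L', hL'⟩ := exists_isBounded_of_simple (M := Q.sub W hW) fun N hN => by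
    by_cases h : N.map (Q.subIncl W hW) = ⊥
    · left
      exact Submodule.map_injective_of_injective (subIncl_injective Q)
        (by rw [h, Submodule.map_bot])
    · right
      have hle : N.map (Q.subIncl W hW) ≤ W :=
        LinearMap.map_le_range.trans (range_subIncl Q).le
      have heq : N.map (Q.subIncl W hW) = W := by
        by_contra hne
        exact hmin _ ⟨isHomogeneous_map_subIncl hN, h⟩ (lt_of_le_of_ne hle hne)
      apply Submodule.map_injective_of_injective (subIncl_injective Q)
      rw [heq, Submodule.map_top, range_subIncl]
  have hle : T ≤ W.comap (M.quotientMk T hT) := fun x hx => by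
    rw [← ker_quotientMk (hN := hT) M, LinearMap.mem_ker] at hx
    rw [Submodule.mem_comap, hx]
    exact zero_mem _
  refine hmax (W.comap (M.quotientMk T hT)) ⟨isHomogeneous_iff.2 fun i x hx => ?_, max L L',
    fun i x hx hxi h0 => ?_⟩ (lt_of_le_of_ne hle fun h => hW0 ?_)
  · rw [Submodule.mem_comap, ← proj_quotientMk]
    exact hW i hx
  · by_cases hq : M.quotientMk T hT x = 0
    · rw [← LinearMap.mem_ker, ker_quotientMk] at hq
      exact (hL i x hq hxi h0).trans (by simp)
    · by_contra! hlt
      refine hq ?_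
      have h1 : Q.subMk hW _ hx = 0 := hL'.eq_zero (i := i) (lt_of_le_of_lt (by simp) hlt) <| by
        rw [mem_piece_sub, subIncl_subMk, mem_piece_iff, proj_quotientMk, proj_eq_self hxi]
      rw [← subIncl_subMk Q (hN := hW) _ hx, h1, map_zero]
  · refine (Submodule.eq_bot_iff _).2 fun y hy => ?_
    obtain ⟨x, rfl⟩ := quotientMk_surjective M y
    have : x ∈ T := h ▸ hy
    rwa [← ker_quotientMk (hN := hT) M] at this

end Support

end GradedRightModule

/-! ### The graded module of Laurent polynomials. -/

/-- The Laurent polynomials over a right module `N` of a graded ring, on which a homogeneous scalar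
of degree `j` acts by its action on coefficients followed by multiplication with `t ^ j`. -/
def LaurentModule {R : Type u} [Ring R] (_ : ℤ → AddSubgroup R) (N : Type u) [AddCommGroup N] :
    Type u :=
  ℤ →₀ N

namespace LaurentModule

variable {R : Type u} [Ring R] (𝒜 : ℤ → AddSubgroup R) (N : Type u) [AddCommGroup N]

noncomputable instance : AddCommGroup (LaurentModule 𝒜 N) :=
  inferInstanceAs (AddCommGroup (ℤ →₀ N))

variable {N}

/-- The monomial `x * t ^ i`. -/
noncomputable def monomial (i : ℤ) : N →+ LaurentModule 𝒜 N :=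
  Finsupp.singleAddHom i

/-- The coefficient of `t ^ i`. -/
noncomputable def coeff (i : ℤ) : LaurentModule 𝒜 N →+ N :=
  Finsupp.applyAddHom i

/-- The additive map out of the Laurent polynomials given by its values on monomials. -/
noncomputable def lift {C : Type*} [AddCommGroup C] (f : ℤ → N →+ C) : LaurentModule 𝒜 N →+ C :=
  Finsupp.liftAddHom f

@[simp]
theorem lift_monomial {C : Type*} [AddCommGroup C] (f : ℤ → N →+ C) (i : ℤ) (x : N) :
    lift 𝒜 f (monomial 𝒜 i x) = f i x :=
  Finsupp.liftAddHom_apply_single f i x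

@[simp]
theorem coeff_monomial_same (i : ℤ) (x : N) : coeff 𝒜 i (monomial 𝒜 i x) = x :=
  Finsupp.single_eq_same

theorem coeff_monomial_of_ne {i j : ℤ} (h : i ≠ j) (x : N) :
    coeff 𝒜 j (monomial 𝒜 i x) = 0 :=
  Finsupp.single_eq_of_ne' h

theorem exists_sum_monomial (f : LaurentModule 𝒜 N) :
    ∃ s : Finset ℤ, ∑ i ∈ s, monomial 𝒜 i (coeff 𝒜 i f) = f :=
  ⟨Finsupp.support f, Finsupp.sum_single f⟩

variable {𝒜} in
theorem hom_ext {C : Type*} [AddCommGroup C] {f g : LaurentModule 𝒜 N →+ C}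
    (h : ∀ i x, f (monomial 𝒜 i x) = g (monomial 𝒜 i x)) : f = g :=
  Finsupp.addHom_ext h

variable [Module Rᵐᵒᵖ N]

/-- The action of a scalar `r` followed by multiplication with `t ^ j`. -/
noncomputable def shiftAct (j : ℤ) : R →+ LaurentModule 𝒜 N →+ LaurentModule 𝒜 N where
  toFun r := lift 𝒜 fun i =>
    (monomial 𝒜 (i + j)).comp (DistribSMul.toAddMonoidHom N (MulOpposite.op r))
  map_zero' := hom_ext fun i x => by
    rw [lift_monomial]
    simp
  map_add' r s := hom_ext fun i x => by
    rw [lift_monomial, AddMonoidHom.add_apply, lift_monomial, lift_monomial]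
    simp [add_smul]

variable [GradedRing 𝒜]

/-- The right action of the graded ring on the Laurent polynomials. -/
noncomputable def act : R →+ LaurentModule 𝒜 N →+ LaurentModule 𝒜 N :=
  (DirectSum.toAddMonoid fun j => (shiftAct 𝒜 j).comp (𝒜 j).subtype).comp
    (DirectSum.decomposeAddEquiv 𝒜).toAddMonoidHom

theorem act_monomial {j : ℤ} {r : R} (hr : r ∈ 𝒜 j) (i : ℤ) (x : N) :
    act 𝒜 r (monomial 𝒜 i x) = monomial 𝒜 (i + j) (MulOpposite.op r • x) := by
  have : act (N := N) 𝒜 r = shiftAct 𝒜 j r := by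
    simp [act, DirectSum.decompose_of_mem _ hr]
  rw [this]
  exact lift_monomial ..

theorem act_one : act (N := N) 𝒜 1 = AddMonoidHom.id _ :=
  hom_ext fun i x => by
    rw [act_monomial 𝒜 (SetLike.GradedOne.one_mem (A := 𝒜))]
    simp

theorem act_mul (r s : R) : act (N := N) 𝒜 (r * s) = (act 𝒜 s).comp (act 𝒜 r) := by
  induction r using GradedRightModule.ring_induction (𝒜 := 𝒜) with
  | zero => simp
  | add r r' hr hr' => rw [add_mul, map_add, map_add, hr, hr', AddMonoidHom.comp_add]
  | homogeneous i r hr =>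
    induction s using GradedRightModule.ring_induction (𝒜 := 𝒜) with
    | zero => simp
    | add s s' hs hs' => rw [mul_add, map_add, map_add, hs, hs', AddMonoidHom.add_comp]
    | homogeneous j s hs =>
      refine hom_ext fun k x => ?_
      rw [act_monomial 𝒜 (SetLike.GradedMul.mul_mem hr hs), AddMonoidHom.comp_apply,
        act_monomial 𝒜 hr, act_monomial 𝒜 hs, MulOpposite.op_mul, mul_smul, add_assoc]

noncomputable instance : Module Rᵐᵒᵖ (LaurentModule 𝒜 N) where
  smul a f := act 𝒜 a.unop f
  one_smul f := DFunLike.congr_fun (act_one 𝒜) f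
  mul_smul a b f := DFunLike.congr_fun (act_mul 𝒜 b.unop a.unop) f
  smul_zero a := map_zero (act 𝒜 a.unop)
  smul_add a f g := map_add (act 𝒜 a.unop) f g
  add_smul a b f := DFunLike.congr_fun (map_add (act 𝒜) a.unop b.unop) f
  zero_smul f := DFunLike.congr_fun (map_zero (act 𝒜)) f

theorem op_smul_monomial {j : ℤ} {r : R} (hr : r ∈ 𝒜 j) (i : ℤ) (x : N) :
    MulOpposite.op r • monomial 𝒜 i x = monomial 𝒜 (i + j) (MulOpposite.op r • x) :=
  act_monomial 𝒜 hr i x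

variable (N)

/-- The Laurent polynomials as a graded module. -/
noncomputable def graded : GradedRightModule 𝒜 :=
  GradedRightModule.ofProj (LaurentModule 𝒜 N) (fun i => (monomial 𝒜 i).comp (coeff 𝒜 i))
    (fun i x => by simp)
    (fun i j x h => by
      simp only [AddMonoidHom.comp_apply]
      rw [coeff_monomial_of_ne 𝒜 (Ne.symm h), map_zero])
    (exists_sum_monomial 𝒜)
    (fun i j r hr f => by
      refine DFunLike.congr_fun (f := ((monomial 𝒜 (i + j)).comp (coeff 𝒜 (i + j))).comp
        (act 𝒜 r)) (g := AddMonoidHom.comp (act 𝒜 r) ((monomial 𝒜 i).comp (coeff 𝒜 i)))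
        (hom_ext fun k x => ?_) f
      simp only [AddMonoidHom.comp_apply]
      rw [act_monomial 𝒜 hr]
      by_cases h : k = i
      · subst h
        rw [coeff_monomial_same, coeff_monomial_same, act_monomial 𝒜 hr]
      · rw [coeff_monomial_of_ne 𝒜 h, coeff_monomial_of_ne 𝒜 (by omega), map_zero, map_zero,
          map_zero])

/-- The monomial `x * t ^ i` in the graded module of Laurent polynomials. -/
noncomputable def gmonomial (i : ℤ) : N →+ (graded 𝒜 N).carrier :=
  monomial 𝒜 i

/-- Evaluation at `t = 1`. -/
noncomputable def eval : (graded 𝒜 N).carrier →ₗ[Rᵐᵒᵖ] N :=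
  GradedRightModule.linearMapOfHomogeneous (𝒜 := 𝒜) (C := LaurentModule 𝒜 N)
    (lift 𝒜 fun _ => AddMonoidHom.id N) fun j r hr f => by
      refine DFunLike.congr_fun (f := AddMonoidHom.comp (lift 𝒜 fun _ => AddMonoidHom.id N)
        (act 𝒜 r)) (g := AddMonoidHom.comp
        (DistribSMul.toAddMonoidHom N (MulOpposite.op r))
        (lift 𝒜 fun _ => AddMonoidHom.id N)) (hom_ext fun k x => ?_) f
      simp only [AddMonoidHom.comp_apply]
      rw [act_monomial 𝒜 hr, lift_monomial, lift_monomial]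
      rfl

variable {N}

theorem eval_gmonomial (i : ℤ) (x : N) : eval 𝒜 N (gmonomial 𝒜 N i x) = x :=
  lift_monomial ..

theorem gmonomial_mem (i : ℤ) (x : N) : gmonomial 𝒜 N i x ∈ (graded 𝒜 N).piece i :=
  ⟨monomial 𝒜 i x, congrArg (monomial 𝒜 i) (coeff_monomial_same 𝒜 i x)⟩

/-- Evaluation loses nothing on a single component; this later makes the degree zero part of `v ∘ u`
the identity. -/
theorem gmonomial_eval {i : ℤ} {z : (graded 𝒜 N).carrier} (hz : z ∈ (graded 𝒜 N).piece i) :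
    gmonomial 𝒜 N i (eval 𝒜 N z) = z := by
  obtain ⟨f, rfl⟩ := hz
  exact congrArg (gmonomial 𝒜 N i) (eval_gmonomial 𝒜 i (coeff 𝒜 i f))

theorem op_smul_gmonomial {j : ℤ} {r : R} (hr : r ∈ 𝒜 j) (i : ℤ) (x : N) :
    MulOpposite.op r • gmonomial 𝒜 N i x = gmonomial 𝒜 N (i + j) (MulOpposite.op r • x) :=
  op_smul_monomial 𝒜 hr i x

end LaurentModule

namespace GradedRightModule

variable {R : Type u} [Ring R] {𝒜 : ℤ → AddSubgroup R}

/-! ### Indecomposable graded summands. -/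

section Summands

variable {M : GradedRightModule 𝒜}

theorem isHomogeneous_sup {N N' : Submodule Rᵐᵒᵖ M.carrier} (hN : N.IsHomogeneous M.piece)
    (hN' : N'.IsHomogeneous M.piece) : (N ⊔ N').IsHomogeneous M.piece :=
  isHomogeneous_iff.2 fun i x hx => by
    obtain ⟨y, hy, z, hz, rfl⟩ := Submodule.mem_sup.1 hx
    rw [map_add]
    exact Submodule.add_mem_sup (hN i hy) (hN' i hz)

theorem isHomogeneous_span [GradedRing 𝒜] {s : Set M.carrier}
    (hs : ∀ x ∈ s, ∃ i, x ∈ M.piece i) : (Submodule.span Rᵐᵒᵖ s).IsHomogeneous M.piece :=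
  isHomogeneous_iff.2 fun i x hx => by
    induction hx using Submodule.closure_induction with
    | zero => simp
    | add x y _ _ hx hy => simpa using Submodule.add_mem _ hx hy
    | smul_mem a x hx =>
      obtain ⟨k, hk⟩ := hs x hx
      obtain ⟨r, rfl⟩ := MulOpposite.op_surjective a
      have := proj_smul_of_mem hk r (i - k)
      rw [add_sub_cancel] at this
      rw [this]
      exact Submodule.smul_mem _ _ (Submodule.subset_span hx)

/-- The projection onto a homogeneous direct summand. -/
noncomputable def subProj {N N' : Submodule Rᵐᵒᵖ M.carrier} (hN : N.IsHomogeneous M.piece)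
    (h : IsCompl N N') : M.carrier →ₗ[Rᵐᵒᵖ] (M.sub N hN).carrier :=
  N.projectionOnto N' h

theorem subProj_subIncl {N N' : Submodule Rᵐᵒᵖ M.carrier} (hN : N.IsHomogeneous M.piece)
    (h : IsCompl N N') (x : (M.sub N hN).carrier) : subProj hN h (M.subIncl N hN x) = x :=
  Submodule.projectionOnto_apply_left h x

theorem subProj_eq_zero {N N' : Submodule Rᵐᵒᵖ M.carrier} (hN : N.IsHomogeneous M.piece)
    (h : IsCompl N N') {x : M.carrier} (hx : x ∈ N') : subProj hN h x = 0 :=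
  (Submodule.projectionOnto_apply_eq_zero_iff h).2 hx

theorem hasDegree_subProj {N N' : Submodule Rᵐᵒᵖ M.carrier} (hN : N.IsHomogeneous M.piece)
    (hN' : N'.IsHomogeneous M.piece) (h : IsCompl N N') :
    HasDegree M (M.sub N hN) 0 (subProj hN h) := fun i x hx => by
  rw [add_zero]
  obtain ⟨y, hy, z, hz, rfl⟩ := Submodule.mem_sup.1 (h.sup_eq_top ▸ Submodule.mem_top (x := x))
  have h1 : ∀ y ∈ N, ∀ z ∈ N', ∀ hy, subProj hN h (y + z) = M.subMk hN y hy := fun y _ z hz hy => by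
    rw [map_add, subProj_eq_zero hN h hz, add_zero]
    exact subProj_subIncl hN h (M.subMk hN y hy)
  have h2 : subProj hN h (y + z) = M.subMk hN _ (hN i hy) := by
    rw [← proj_eq_self hx, map_add]
    exact h1 _ (hN i hy) _ (hN' i hz) _
  rw [h2, mem_piece_sub, subIncl_subMk]
  exact proj_mem i y

/-- An artinian graded module with a nonzero component of degree `k` has an indecomposable direct
summand with this property. -/
theorem exists_indecomposable_summand [IsArtinian Rᵐᵒᵖ M.carrier] {k : ℤ} (hk : M.piece k ≠ ⊥) :
    ∃ (B B' : Submodule Rᵐᵒᵖ M.carrier) (hB : B.IsHomogeneous M.piece)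
      (_ : B'.IsHomogeneous M.piece) (_ : IsCompl B B'),
      (M.sub B hB).IsIndecomposable ∧ (M.sub B hB).piece k ≠ ⊥ := by
  obtain ⟨x, hx, hx0⟩ := (AddSubgroup.bot_or_exists_ne_zero _).resolve_left hk
  obtain ⟨B, ⟨hB, ⟨B', hB', hc⟩, b, hbB, hbk, hb0⟩, hmin⟩ :=
    (wellFounded_lt (α := Submodule Rᵐᵒᵖ M.carrier)).has_min
    {B | B.IsHomogeneous M.piece ∧ (∃ B' : Submodule Rᵐᵒᵖ M.carrier,
      B'.IsHomogeneous M.piece ∧ IsCompl B B') ∧ ∃ x ∈ B, x ∈ M.piece k ∧ x ≠ 0}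
    ⟨⊤, isHomogeneous_iff.2 fun _ _ _ => trivial,
      ⟨⊥, isHomogeneous_iff.2 fun i x hx => by simp_all, isCompl_top_bot⟩, x, trivial, hx, hx0⟩
  set c := M.subMk hB b hbB with hc_def
  have hck : c ∈ (M.sub B hB).piece k := (mem_piece_sub M).2 hbk
  have hc0 : c ≠ 0 := fun h => hb0 <| by
    rw [← subIncl_subMk (hN := hB) M b hbB, ← hc_def, h, map_zero]
  -- A graded summand of `B` that is nonzero in degree `k` is also one of `M`, so minimality of `B`
  -- makes it all of `B`.
  have key : ∀ N N' : Submodule Rᵐᵒᵖ (M.sub B hB).carrier, N.IsHomogeneous (M.sub B hB).piece →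
      N'.IsHomogeneous (M.sub B hB).piece → IsCompl N N' →
      ∀ y ∈ N, y ∈ (M.sub B hB).piece k → y ≠ 0 → N' = ⊥ := by
    intro N N' hN hN' hNN' y hyN hyk hy0
    have hinj := subIncl_injective (hN := hB) M
    have hsup : N.map (M.subIncl B hB) ⊔ N'.map (M.subIncl B hB) = B := by
      rw [← Submodule.map_sup, hNN'.sup_eq_top, Submodule.map_top, range_subIncl]
    have hdisj : Disjoint (N.map (M.subIncl B hB)) (N'.map (M.subIncl B hB)) :=
      (Submodule.disjoint_map hinj hNN'.disjoint)
    have hcompl : IsCompl (N.map (M.subIncl B hB)) (N'.map (M.subIncl B hB) ⊔ B') :=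
      ⟨hdisj.disjoint_sup_right_of_disjoint_sup_left (by rw [hsup]; exact hc.disjoint),
        codisjoint_iff.2 (by rw [← sup_assoc, hsup, hc.sup_eq_top])⟩
    have heq : N.map (M.subIncl B hB) = B := by
      by_contra hne
      refine hmin _ ⟨isHomogeneous_map_subIncl hN,
        ⟨_, isHomogeneous_sup (isHomogeneous_map_subIncl hN') hB', hcompl⟩,
        M.subIncl B hB y, ⟨y, hyN, rfl⟩, (mem_piece_sub M).1 hyk, fun h => hy0 (hinj ?_)⟩
        (lt_of_le_of_ne (le_sup_left.trans hsup.le) hne)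
      rw [h, map_zero]
    have htop : N = ⊤ := Submodule.map_injective_of_injective hinj <| by
      rw [heq, Submodule.map_top, range_subIncl]
    rw [htop] at hNN'
    exact eq_bot_of_top_isCompl hNN'
  refine ⟨B, B', hB, hB', hc, ⟨⟨c, 0, hc0⟩, fun N N' hN hN' hNN' => ?_⟩, fun h => hc0 ?_⟩
  · obtain ⟨y, hy, z, hz, hyz⟩ :=
      Submodule.mem_sup.1 (hNN'.sup_eq_top ▸ Submodule.mem_top (x := c))
    have hsum : (M.sub B hB).proj k y + (M.sub B hB).proj k z = c := by
      rw [← map_add, hyz, proj_eq_self hck]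
    by_cases h0 : (M.sub B hB).proj k y = 0
    · left
      refine key N' N hN' hN hNN'.symm _ (hN' k hz) (proj_mem k z) fun h => hc0 ?_
      rw [← hsum, h0, zero_add]
      exact h
    · right
      exact key N N' hN hN' hNN' _ (hN k hy) (proj_mem k y) h0
  · rwa [h, AddSubgroup.mem_bot] at hck

/-- The graded length is invariant under shifts; a nonzero component in degree 0 anchors the
support. -/
theorem isBounded_of_gradedLength_le {G : ℕ} (h0 : M.piece 0 ≠ ⊥) (hG : M.gradedLength ≤ G) :
    M.IsBounded G := by
  intro i hi
  have key : ∀ a b : ℤ, a ≤ b → M.piece a ≠ ⊥ → M.piece b ≠ ⊥ → (b - a).toNat + 1 ≤ G := by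
    intro a b hab ha hb
    have h : (((b - a).toNat + 1 : ℕ) : ℕ∞) ≤ M.gradedLength :=
      le_iSup_of_le a (le_iSup_of_le b (le_iSup_of_le hab (le_iSup_of_le ha
        (le_iSup_of_le hb le_rfl))))
    exact_mod_cast h.trans hG
  rcases le_total 0 i with h | h
  · have := key 0 i h h0 hi
    rw [abs_of_nonneg h]
    omega
  · have := key i 0 h hi h0
    rw [abs_of_nonpos h]
    omega

theorem gradedLength_le_supGradedLength (hfin : Module.Finite Rᵐᵒᵖ M.carrier)
    (hind : M.IsIndecomposable) : M.gradedLength ≤ supGradedLength 𝒜 := by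
  unfold supGradedLength
  refine le_iSup_of_le M ?_
  refine le_iSup_of_le hfin ?_
  exact le_iSup (fun _ : M.IsIndecomposable => M.gradedLength) hind

end Summands

/-! ### Gradability from bounded graded lengths. -/

section Gradable

variable (𝒜) in
/-- A graded ring as a graded right module over itself. -/
def regular [GradedRing 𝒜] : GradedRightModule 𝒜 where
  carrier := R
  piece := 𝒜
  smul_mem _ _ _ _ hm hr := SetLike.GradedMul.mul_mem hm hr

variable [GradedRing 𝒜] [IsArtinianRing Rᵐᵒᵖ]

open LaurentModule in
/-- If the finitely generated indecomposable graded modules have graded length at most `G`, then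
every nonzero finitely generated module has a nonzero gradable direct summand. -/
theorem exists_gradable_summand {s G : ℕ} (hs : ∀ j : ℤ, s < |j| → ∀ r ∈ 𝒜 j, r = 0)
    (hG : supGradedLength 𝒜 ≤ G) (N : Type u) [AddCommGroup N] [Module Rᵐᵒᵖ N]
    [Module.Finite Rᵐᵒᵖ N] [Nontrivial N] :
    ∃ (B : GradedRightModule 𝒜) (u : B.carrier →ₗ[Rᵐᵒᵖ] N) (v : N →ₗ[Rᵐᵒᵖ] B.carrier),
      Nontrivial B.carrier ∧ Function.Bijective (v ∘ₗ u) := by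
  classical
  -- Linearity of `v` needs degrees `i` with `|i + j| ≤ G` and `|j| ≤ s`, that is `|i| ≤ G + s`. To
  -- generate `N * t ^ i` for such `i`, generators are taken in a window wider by another `s`.
  set n : ℕ := G + s with hn
  set P := graded 𝒜 N with hP
  obtain ⟨g, hg⟩ := Module.Finite.fg_top (R := Rᵐᵒᵖ) (M := N)
  set S : Finset P.carrier := (Finset.Icc (-(n + s : ℤ)) (n + s) ×ˢ g).image
    fun p => gmonomial 𝒜 N p.1 p.2 with hS
  set X : Submodule Rᵐᵒᵖ P.carrier := Submodule.span Rᵐᵒᵖ (S : Set P.carrier) with hXdef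
  have hX : X.IsHomogeneous P.piece := isHomogeneous_span fun x hx => by
    obtain ⟨p, -, rfl⟩ := Finset.mem_image.1 (Finset.mem_coe.1 hx)
    exact ⟨_, gmonomial_mem 𝒜 _ _⟩
  have hmem : ∀ i : ℤ, |i| ≤ n → ∀ x : N, gmonomial 𝒜 N i x ∈ X := by
    intro i hi x
    have hx : x ∈ Submodule.span Rᵐᵒᵖ (g : Set N) := hg ▸ Submodule.mem_top
    induction hx using Submodule.closure_induction with
    | zero => simp
    | add x y _ _ hx hy => simpa using Submodule.add_mem _ hx hy
    | smul_mem a y hy =>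
      obtain ⟨r, rfl⟩ := MulOpposite.op_surjective a
      induction r using ring_induction (𝒜 := 𝒜) with
      | zero => simp
      | add r r' hr hr' => simpa [add_smul] using Submodule.add_mem _ hr hr'
      | homogeneous j r hr =>
        by_cases hj : (s : ℤ) < |j|
        · simp [hs j hj r hr]
        · have := op_smul_gmonomial 𝒜 hr (i - j) y
          rw [sub_add_cancel] at this
          rw [← this]
          refine Submodule.smul_mem _ _ (Submodule.subset_span (Finset.mem_coe.2
            (Finset.mem_image.2 ⟨(i - j, y), Finset.mem_product.2 ⟨?_, hy⟩, rfl⟩)))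
          rw [not_lt, abs_le] at hj
          rw [abs_le] at hi
          rw [Finset.mem_Icc]
          constructor <;> dsimp only <;> omega
  set Y := P.sub X hX with hY
  have hYfin : Module.Finite Rᵐᵒᵖ Y.carrier :=
    Module.Finite.iff_fg.2 (Submodule.fg_span S.finite_toSet)
  have hY0 : Y.piece 0 ≠ ⊥ := by
    obtain ⟨x, hx⟩ := exists_ne (0 : N)
    intro h
    have h1 : P.subMk hX _ (hmem 0 (by simp) x) ∈ Y.piece 0 :=
      (mem_piece_sub P).2 (gmonomial_mem 𝒜 0 x)
    rw [h, AddSubgroup.mem_bot] at h1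
    apply hx
    rw [← eval_gmonomial 𝒜 0 x, ← subIncl_subMk (hN := hX) P _ (hmem 0 (by simp) x), h1, map_zero,
      map_zero]
  obtain ⟨B, B', hB, hB', hc, hind, hB0⟩ := exists_indecomposable_summand hY0
  set Z := Y.sub B hB with hZ
  have hZart : IsArtinian Rᵐᵒᵖ Z.carrier := isArtinian_of_injective _ (subIncl_injective Y)
  have hZnoe : IsNoetherian Rᵐᵒᵖ Z.carrier := isNoetherian_of_injective _ (subIncl_injective Y)
  have hZfin : Module.Finite Rᵐᵒᵖ Z.carrier := inferInstance
  have hZlen : Z.gradedLength ≤ G :=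
    (gradedLength_le_supGradedLength hZfin hind).trans hG
  have hZb : Z.IsBounded G := isBounded_of_gradedLength_le hB0 hZlen
  set q : Y.carrier →ₗ[Rᵐᵒᵖ] Z.carrier := subProj hB hc with hq
  have hqdeg : HasDegree Y Z 0 q := hasDegree_subProj hB hB' hc
  have hw : ∀ i : ℤ, ∃ w : N →+ Z.carrier,
      (∀ hi : |i| ≤ n, ∀ x, w x = q (P.subMk hX _ (hmem i hi x))) ∧ (n < |i| → w = 0) := by
    intro i
    by_cases hi : |i| ≤ n
    · refine ⟨AddMonoidHom.mk' (fun x => q (P.subMk hX _ (hmem i hi x))) fun x y => ?_,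
        fun _ _ => rfl, fun h => absurd h (not_lt.2 hi)⟩
      rw [← map_add]
      congr 1
      apply subIncl_injective P
      rw [map_add (P.subIncl X hX), subIncl_subMk, subIncl_subMk, subIncl_subMk, map_add]
    · exact ⟨0, fun h => absurd h hi, fun _ => rfl⟩
  choose w hw hw0 using hw
  have hwmem : ∀ i x, w i x ∈ Z.piece i := by
    intro i x
    by_cases hi : |i| ≤ n
    · rw [hw i hi]
      have := hqdeg i (P.subMk hX _ (hmem i hi x)) ((mem_piece_sub P).2 (gmonomial_mem 𝒜 i x))
      rwa [add_zero] at this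
    · rw [hw0 i (not_le.1 hi)]
      exact zero_mem _
  have hwzero : ∀ i, (G : ℤ) < |i| → ∀ x, w i x = 0 := fun i hi x => hZb.eq_zero hi (hwmem i x)
  -- Both sides lie in degree `i + j` of `Z`, hence vanish if `|i + j| > G`; otherwise `i` and `i +
  -- j` are both in the window where `w` is given by `q`.
  have hwsmul : ∀ i j, ∀ r ∈ 𝒜 j, ∀ x,
      w (i + j) (MulOpposite.op r • x) = MulOpposite.op r • w i x := by
    intro i j r hr x
    by_cases hj : (s : ℤ) < |j|
    · simp [hs j hj r hr]
    by_cases hij : (G : ℤ) < |i + j|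
    · rw [hwzero _ hij]
      exact (hZb.eq_zero hij (Z.smul_mem i j _ r (hwmem i x) hr)).symm
    have hi : |i| ≤ n := by
      rw [not_lt, abs_le] at hj hij
      rw [abs_le]
      omega
    have hij' : |i + j| ≤ n := (not_lt.1 hij).trans (by omega)
    rw [hw i hi, hw (i + j) hij', ← map_smul]
    congr 1
    apply subIncl_injective P
    rw [map_smul (P.subIncl X hX), subIncl_subMk, subIncl_subMk, op_smul_gmonomial 𝒜 hr]
  set v₀ : N →+ Z.carrier := ∑ i ∈ Finset.Icc (-G : ℤ) G, w i with hv₀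
  have hv₀proj : ∀ k x, Z.proj k (v₀ x) = w k x := by
    intro k x
    rw [hv₀, AddMonoidHom.finsetSum_apply, map_sum]
    by_cases hk : (G : ℤ) < |k|
    · rw [hwzero k hk]
      exact Finset.sum_eq_zero fun i _ => hZb.eq_zero hk (proj_mem k _)
    · rw [Finset.sum_eq_single k (fun i _ hi => proj_eq_zero (hwmem i x) hi),
        proj_eq_self (hwmem k x)]
      intro h
      rw [not_lt, abs_le] at hk
      exact absurd (Finset.mem_Icc.2 hk) h
  set v : N →ₗ[Rᵐᵒᵖ] Z.carrier := linearMapOfHomogeneous (𝒜 := 𝒜) v₀ fun j r hr x =>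
    ext_proj fun k => by
      have h1 := hwsmul (k - j) j r hr x
      have h2 := proj_smul (M := Z) hr (k - j) (v₀ x)
      rw [sub_add_cancel] at h1 h2
      rw [h2, hv₀proj, hv₀proj, h1] with hv
  set u : Z.carrier →ₗ[Rᵐᵒᵖ] N := eval 𝒜 N ∘ₗ P.subIncl X hX ∘ₗ Y.subIncl B hB with hu
  refine ⟨Z, u, v, hind.1, ?_⟩
  rw [← Module.End.isUnit_iff]
  refine isUnit_of_component_zero_eq_one hind hZb (LinearMap.ext fun b => ?_)
  induction b using homogeneous_induction with
  | zero => simp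
  | add x y hx hy => rw [map_add, hx, hy, map_add]
  -- The degree `i` part of `v (u b)` is `q (u b * t ^ i)`, and `u b * t ^ i` is `b` itself seen in
  -- `N[t, t⁻¹]`.
  | homogeneous i b hb =>
    rw [component_apply 0 _ hb, add_zero, LinearMap.comp_apply, hv, linearMapOfHomogeneous_apply,
      hv₀proj, LinearMap.id_apply]
    by_cases hi : (G : ℤ) < |i|
    · rw [hwzero i hi, hZb.eq_zero hi hb]
    have hi' : |i| ≤ n := (not_lt.1 hi).trans (by omega)
    rw [hw i hi', ← subProj_subIncl hB hc b]
    refine congrArg q (subIncl_injective P ?_)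
    rw [subIncl_subMk, subProj_subIncl]
    exact gmonomial_eval 𝒜 ((mem_piece_sub P).1 ((mem_piece_sub Y).1 hb))

/-- If the finitely generated indecomposable graded modules have bounded graded length, then every
finitely generated module is gradable. -/
theorem everyFGModuleGradable {s G : ℕ} (hs : ∀ j : ℤ, s < |j| → ∀ r ∈ 𝒜 j, r = 0)
    (hG : supGradedLength 𝒜 ≤ G) : EveryFGModuleGradable 𝒜 := by
  intro N _ _ hN
  suffices h : ∀ K : Submodule Rᵐᵒᵖ N, IsGradable 𝒜 K by
    obtain ⟨M, ⟨e⟩⟩ := h ⊤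
    exact ⟨M, ⟨e.trans Submodule.topEquiv⟩⟩
  intro K
  induction K using WellFoundedLT.induction with
  | ind K ih =>
    rcases subsingleton_or_nontrivial K with hK | hK
    · refine ⟨ofProj K (fun _ => 0) (fun _ _ => rfl) (fun _ _ _ _ => rfl)
        (fun x => ⟨∅, Subsingleton.elim _ _⟩) (fun _ _ _ _ _ => Subsingleton.elim _ _),
        ⟨LinearEquiv.refl _ _⟩⟩
    obtain ⟨B, u, v, hB, huv⟩ := exists_gradable_summand hs hG K
    -- Since `v ∘ u` is bijective, `K` splits as a copy of `B` and `ker v`, which is proper because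
    -- `B` is nonzero.
    have hc : IsCompl (LinearMap.range u) (LinearMap.ker v) := by
      refine ⟨Submodule.disjoint_def.2 ?_, codisjoint_iff.2 (eq_top_iff.2 fun x _ => ?_)⟩
      · rintro _ ⟨b, rfl⟩ hb
        rw [huv.1 (a₁ := b) (a₂ := 0) (by rw [map_zero]; exact hb), map_zero]
      · obtain ⟨b, hb⟩ := huv.2 (v x)
        refine Submodule.mem_sup.2 ⟨u b, ⟨b, rfl⟩, x - u b, ?_, by simp⟩
        rw [LinearMap.mem_ker, map_sub, ← hb]
        exact sub_self _
    have hlt : (LinearMap.ker v).map K.subtype < K := by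
      refine lt_of_le_of_ne (Submodule.map_subtype_le K _) fun h => ?_
      have htop : LinearMap.ker v = ⊤ := by
        apply Submodule.map_injective_of_injective K.injective_subtype
        rw [h, Submodule.map_top, Submodule.range_subtype]
      rw [htop] at hc
      obtain ⟨b, hb⟩ := exists_ne (0 : B.carrier)
      have hu0 := LinearMap.range_eq_bot.1 (eq_bot_of_isCompl_top hc)
      exact hb (huv.1 (by simp [hu0]))
    obtain ⟨C, ⟨e⟩⟩ := ih _ hlt
    refine ⟨B.prod C, ⟨?_⟩⟩
    have e₁ : B.carrier ≃ₗ[Rᵐᵒᵖ] LinearMap.range u :=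
      LinearEquiv.ofInjective u (Function.Injective.of_comp (f := v) huv.1)
    have e₂ : C.carrier ≃ₗ[Rᵐᵒᵖ] LinearMap.ker v :=
      e.trans (Submodule.equivMapOfInjective K.subtype K.injective_subtype _).symm
    exact (e₁.prodCongr e₂).trans (Submodule.prodEquivOfIsCompl _ _ hc)

end Gradable

/-! ### Bounds from artinianity and from finiteness. -/

theorem isArtinianRing_op (hR : IsArtinian Rᵐᵒᵖ R) : IsArtinianRing Rᵐᵒᵖ := by
  let e : R →ₗ[Rᵐᵒᵖ] Rᵐᵒᵖ :=
    { toFun := MulOpposite.op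
      map_add' := fun _ _ => rfl
      map_smul' := fun _ _ => rfl }
  exact isArtinian_of_surjective R e MulOpposite.op_surjective

/-- An artinian graded ring has bounded support. -/
theorem exists_forall_eq_zero [GradedRing 𝒜] [IsArtinianRing Rᵐᵒᵖ] (hR : IsArtinian Rᵐᵒᵖ R) :
    ∃ s : ℕ, ∀ j : ℤ, s < |j| → ∀ r ∈ 𝒜 j, r = 0 := by
  have : IsArtinian Rᵐᵒᵖ (regular 𝒜).carrier := hR
  -- Hopkins–Levitzki.
  have : IsNoetherian Rᵐᵒᵖ (regular 𝒜).carrier := ((IsArtinianRing.tfae Rᵐᵒᵖ R).out 2 1).1 hR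
  obtain ⟨s, hs⟩ := exists_isBounded (regular 𝒜)
  exact ⟨s, fun j hj r hr => hs.eq_zero hj hr⟩

/-- If there are only finitely many finitely generated indecomposable gradable modules, then the
graded lengths of the finitely generated indecomposable graded modules are bounded. -/
theorem supGradedLength_lt_top [GradedRing 𝒜] [IsArtinianRing Rᵐᵒᵖ]
    (h : FinitelyManyGradableIndecomposables 𝒜) : supGradedLength 𝒜 < ⊤ := by
  obtain ⟨n, X, hX, hall⟩ := h
  have hbdd : ∀ M : GradedRightModule 𝒜, Module.Finite Rᵐᵒᵖ M.carrier → ∃ L, M.IsBounded L :=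
    fun M _ => exists_isBounded M
  choose M e using fun k => (hX k).2.2
  have hfin : ∀ k, Module.Finite Rᵐᵒᵖ (M k).carrier := fun k =>
    have := (hX k).1
    Module.Finite.equiv (e k).some.symm
  refine lt_of_le_of_lt (b := Finset.univ.sup fun k => (M k).gradedLength) ?_ ?_
  · refine iSup_le fun C => iSup_le fun hC => iSup_le fun hind => ?_
    obtain ⟨L, hL⟩ := hbdd C hC
    obtain ⟨k, ⟨φ⟩⟩ := hall (ModuleCat.of Rᵐᵒᵖ C.carrier)
      ⟨hC, hind.isIndecomposableModule hL, C, ⟨LinearEquiv.refl _ _⟩⟩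
    obtain ⟨L', hL'⟩ := hbdd (M k) (hfin k)
    -- The isomorphism need not respect the gradings of `C` and `M k`; an injective component
    -- suffices to compare lengths.
    obtain ⟨d, hd⟩ := exists_injective_component hind hL hL' (φ.trans (e k).some.symm)
    exact ((hasDegree_component d _).gradedLength_le hd).trans
      (Finset.le_sup (f := fun k => (M k).gradedLength) (Finset.mem_univ k))
  · rw [Finset.sup_lt_iff (by simp)]
    intro k _
    obtain ⟨L, hL⟩ := hbdd (M k) (hfin k)
    exact hL.gradedLength_lt_top

end GradedRightModule

/-! ### Representation type and the main theorem. -/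

theorem FinitelyManyUpToIso.and {S : Type u} [Ring S] {P Q : ModuleCat.{u} S → Prop}
    (hP : FinitelyManyUpToIso P) (hQ : ∀ M N : ModuleCat.{u} S, Nonempty (M ≃ₗ[S] N) → Q M → Q N) :
    FinitelyManyUpToIso fun M => P M ∧ Q M := by
  classical
  obtain ⟨n, X, hX, hall⟩ := hP
  let e := Fintype.equivFin {k // Q (X k)}
  refine ⟨_, fun k => X (e.symm k).1, fun k => ⟨hX _, (e.symm k).2⟩, fun M hM => ?_⟩
  obtain ⟨k, hk⟩ := hall M hM.1
  refine ⟨e ⟨k, hQ _ _ hk hM.2⟩, ?_⟩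
  beta_reduce
  rw [e.symm_apply_apply]
  exact hk

theorem FiniteRepresentationType.finitelyManyGradableIndecomposables {R : Type u} [Ring R]
    {𝒜 : ℤ → AddSubgroup R} (h : FiniteRepresentationType R) :
    FinitelyManyGradableIndecomposables 𝒜 := by
  have := FinitelyManyUpToIso.and (Q := fun M => IsGradable 𝒜 M) h fun M N ⟨φ⟩ ⟨C, ⟨e⟩⟩ =>
    ⟨C, ⟨e.trans φ⟩⟩
  simpa only [FinitelyManyGradableIndecomposables, and_assoc] using this

theorem FinitelyManyGradableIndecomposables.finiteRepresentationType {R : Type u} [Ring R]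
    {𝒜 : ℤ → AddSubgroup R} (h : FinitelyManyGradableIndecomposables 𝒜)
    (hall : EveryFGModuleGradable 𝒜) : FiniteRepresentationType R := by
  obtain ⟨n, X, hX, hiso⟩ := h
  exact ⟨n, X, fun k => ⟨(hX k).1, (hX k).2.1⟩, fun M hM => hiso M ⟨hM.1, hM.2, hall M hM.1⟩⟩

theorem theorem1p1 {R : Type u} [Ring R] (𝒜 : ℤ → AddSubgroup R) [GradedRing 𝒜]
    (hR : IsArtinian Rᵐᵒᵖ R) :
    (supGradedLength 𝒜 < ⊤ → EveryFGModuleGradable 𝒜) ∧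
    (FiniteRepresentationType R ↔ FinitelyManyGradableIndecomposables 𝒜) ∧
    (FiniteRepresentationType R → EveryFGModuleGradable 𝒜) := by
  have := GradedRightModule.isArtinianRing_op hR
  obtain ⟨s, hs⟩ := GradedRightModule.exists_forall_eq_zero (𝒜 := 𝒜) hR
  have h1 : supGradedLength 𝒜 < ⊤ → EveryFGModuleGradable 𝒜 := fun h => by
    obtain ⟨G, hG⟩ := ENat.ne_top_iff_exists.1 h.ne
    exact GradedRightModule.everyFGModuleGradable hs hG.ge
  have h2 : FinitelyManyGradableIndecomposables 𝒜 → EveryFGModuleGradable 𝒜 := fun h =>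
    h1 (GradedRightModule.supGradedLength_lt_top h)
  exact ⟨h1, ⟨fun h => h.finitelyManyGradableIndecomposables,
    fun h => h.finiteRepresentationType (h2 h)⟩,
    fun h => h2 h.finitelyManyGradableIndecomposables⟩
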